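/- Let $\mathbf k$ be a field. An $\mathbb S$-module is a family $M=(M(n))_{n\ge 0}$ of $\mathbf k$-vector spaces with a right action of $S_n$ on $M(n)$. The tensor product of $\mathbb S$-modules is $$(M\otimes_{\mathbb S} N)(n)=\bigoplus_{p+q=n}(M(p)\otimes N(q))\otimes_{\mathbf k[S_p\times S_q]}\mathbf k[S_n]=\bigoplus_{I\sqcup J=[n]}M(|I|)\otimes N(|J|),$$ the last sum being over ordered partitions $(I,J)$ of $[n]=\{1,\dots,n\}$; graded vector spaces have the tensor product $(A\otimes_g B)_n=\bigoplus_{p+q=n}A_p\otimes B_q$ with the symmetry $a\otimes b\mapsto b\otimes a$. Let $O$ be the forgetful functor from $\mathbb S$-modules to graded vector spaces, and let $$\pi_{M,N}:O(M\otimes_{\mathbb S}N)\to O(M)\otimes_g O(N)$$ be the map that sends $m\otimes n\otimes(I,J)$, for $m\in M(p)$ and $n\in N(q)$, to $m\otimes n$ if $(I,J)=([p],p+[q])$ and to $0$ otherwise. For an operad $\mathcal P$, a $\mathcal P$-algebra in either category is an algebra over the monad $X\mapsto\mathcal P\circ X=\bigoplus_k \mathcal P(k)\otimes_{S_k}X^{\otimes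 k}$. A Hopf operad is an operad in coassociative counital coalgebras; over a Hopf operad the tensor product of two $\mathcal P$-algebras and the unit object are again $\mathcal P$-algebras, and a Hopf $\mathcal P$-algebra is a $\mathcal P$-algebra with a coassociative coproduct $\Delta$ and a counit $\epsilon$ which are morphisms of $\mathcal P$-algebras. **Theorem.** Let $\mathcal P$ be a Hopf operad and let $(M,\mu,\Delta,\epsilon)$ be a Hopf $\mathcal P$-algebra in $\mathbb S$-modules. Define on the graded vector space $O(M)$ the product $$\hat\mu(p\otimes m_1\otimes\cdots\otimes m_k)=\sum_{(T_1,\dots,T_k)}\mu\bigl(p\otimes m_1\otimes\cdots\otimes m_k\otimes(T_1,\dots,T_k)\bigr)\qquad(p\in\mathcal P(k),\ m_i\in M(l_i)),$$ the sum being over all ordered partitions $(T_1,\dots,T_k)$ of $[l_1+\cdots+l_k]$ with $|T_i|=l_i$, and the coproduct $$\bar\Delta=\pi_{M,M}\circ O(\Delta):O(M)\to O(M)\otimes_g O(M).$$ Then $(O(M),\hat\mu,\bar\Delta,\epsilon)$ is a Hopf $\mathcal P$-algebra in graded vector spaces (the symmetrized Hopf $\mathcal P$-algebra of $M$). Moreover,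 if $m\in M(n)$ and $\Delta(m)=\sum_{S\sqcup T=[n]}\sum m_{(1)}^{(S,T)}\otimes m_{(2)}^{(S,T)}\otimes(S,T)$, then $$\bar\Delta(m)=\sum_{i=0}^{n}\sum m_{(1)}^{([i],\,i+[n-i])}\otimes m_{(2)}^{([i],\,i+[n-i])}.$$ -/

import Mathlib

open scoped TensorProduct DirectSum
open Finset

universe u v w w'

noncomputable section

namespace TwistedHopf

/-! ## Multilinear maps on tensor products -/

section Pairing

variable {K : Type u} [Field K]

/-- Given multilinear maps `f : ∏ X i → U` and `g : ∏ Y i → V`, the multilinear map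
`∏ (X i ⊗ Y i) → U ⊗ V` with `(x i ⊗ y i)ᵢ ↦ f x ⊗ g y` (see `tensorPair_tmul`), as a bilinear
function of `(f, g)`. -/
def tensorPair {U V : Type*} [AddCommGroup U] [Module K U] [AddCommGroup V] [Module K V] :
    (k : ℕ) → (X : Fin k → Type w) → (Y : Fin k → Type w') →
    [∀ i, AddCommGroup (X i)] → [∀ i, Module K (X i)] →
    [∀ i, AddCommGroup (Y i)] → [∀ i, Module K (Y i)] →
    MultilinearMap K X U →ₗ[K] MultilinearMap K Y V →ₗ[K]
      MultilinearMap K (fun i => X i ⊗[K] Y i) (U ⊗[K] V)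
  | 0, _, _, _, _, _, _ =>
    LinearMap.mk₂ K
      (fun f g => MultilinearMap.constOfIsEmpty K _ (f isEmptyElim ⊗ₜ[K] g isEmptyElim))
      (fun f f' g => by ext x; simp [TensorProduct.add_tmul])
      (fun c f g => by ext x; simp [TensorProduct.smul_tmul'])
      (fun f g g' => by ext x; simp [TensorProduct.tmul_add])
      (fun c f g => by ext x; simp)
  | k + 1, X, Y, _, _, _, _ =>
    ((TensorProduct.mapBilinear (RingHom.id K) _ _ _ _).compr₂
      ((multilinearCurryLeftEquiv K (fun i => X i ⊗[K] Y i) (U ⊗[K] V)).symm.toLinearMap ∘ₗ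
        LinearMap.compRight K (TensorProduct.lift
          (tensorPair k (fun i => X i.succ) (fun i => Y i.succ))))).compl₁₂
      (multilinearCurryLeftEquiv K X U).toLinearMap (multilinearCurryLeftEquiv K Y V).toLinearMap

theorem tensorPair_tmul {U V : Type*} [AddCommGroup U] [Module K U] [AddCommGroup V]
    [Module K V] (k : ℕ) (X : Fin k → Type w) (Y : Fin k → Type w')
    [∀ i, AddCommGroup (X i)] [∀ i, Module K (X i)]
    [∀ i, AddCommGroup (Y i)] [∀ i, Module K (Y i)]
    (f : MultilinearMap K X U) (g : MultilinearMap K Y V) (x : ∀ i, X i) (y : ∀ i, Y i) :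
    tensorPair k X Y f g (fun i => x i ⊗ₜ[K] y i) = f x ⊗ₜ[K] g y := by
  induction k with
  | zero =>
    have hx : x = isEmptyElim := Subsingleton.elim _ _
    have hy : y = isEmptyElim := Subsingleton.elim _ _
    subst hx hy
    simp [tensorPair]
  | succ k ih =>
    have h := ih (fun i => X i.succ) (fun i => Y i.succ) (f.curryLeft (x 0))
      (g.curryLeft (y 0)) (Fin.tail x) (Fin.tail y)
    simp only [MultilinearMap.curryLeft_apply, Fin.cons_self_tail] at h
    rw [← h]
    rfl

/-- The pairing `φ ⊗ ψ` of two linear families of multilinear operations: an element `p ⊗ p'`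
gives the operation `(x i ⊗ y i)ᵢ ↦ φ p x ⊗ ψ p' y`. -/
def pairOps {U V P P' : Type*} [AddCommGroup U] [Module K U] [AddCommGroup V] [Module K V]
    [AddCommGroup P] [Module K P] [AddCommGroup P'] [Module K P']
    {k : ℕ} {X : Fin k → Type w} {Y : Fin k → Type w'}
    [∀ i, AddCommGroup (X i)] [∀ i, Module K (X i)]
    [∀ i, AddCommGroup (Y i)] [∀ i, Module K (Y i)]
    (φ : P →ₗ[K] MultilinearMap K X U) (ψ : P' →ₗ[K] MultilinearMap K Y V) :
    P ⊗[K] P' →ₗ[K] MultilinearMap K (fun i => X i ⊗[K] Y i) (U ⊗[K] V) :=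
  TensorProduct.lift ((tensorPair k X Y).compl₁₂ φ ψ)

end Pairing

/-! ## Graded vector spaces and `𝕊`-modules -/

/-- A graded vector space over `K`: vector spaces `A n` for `n ≥ 0`. -/
structure GrVect (K : Type u) [Field K] where
  carrier : ℕ → Type w
  [addCommGroup : ∀ n, AddCommGroup (carrier n)]
  [module : ∀ n, Module K (carrier n)]

instance {K : Type u} [Field K] : CoeFun (GrVect.{u, w} K) (fun _ => ℕ → Type w) :=
  ⟨GrVect.carrier⟩

attribute [instance] GrVect.addCommGroup GrVect.module

/-- An `𝕊`-module over `K`: a graded vector space with a right action of the symmetric group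
`S_n` (a representation of the opposite group) in each degree `n`. -/
structure SMod (K : Type u) [Field K] extends GrVect.{u, w} K where
  ρ : ∀ n, Representation K (Equiv.Perm (Fin n))ᵐᵒᵖ (carrier n)

variable {K : Type u} [Field K]

instance : CoeFun (SMod.{u, w} K) (fun _ => ℕ → Type w) := ⟨fun M => M.carrier⟩

namespace SMod

/-- The right action `m ↦ m · σ`. -/
abbrev act (M : SMod.{u, w} K) {n : ℕ} (σ : Equiv.Perm (Fin n)) : M n →ₗ[K] M n :=
  M.ρ n (MulOpposite.op σ)

/-- The right action of a permutation whose source `Fin m` and target `Fin n` are only known to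
have the same size: as `m = n` it is `m ↦ m · σ`. -/
def relabel (M : SMod.{u, w} K) {m n : ℕ} (σ : Fin m ≃ Fin n) : M n →ₗ[K] M m :=
  if h : m = n then by subst h; exact M.act σ else 0

theorem relabel_eq_act (M : SMod.{u, w} K) {n : ℕ} (σ : Equiv.Perm (Fin n)) :
    M.relabel σ = M.act σ := by
  simp [relabel]

theorem relabel_refl (M : SMod.{u, w} K) {n : ℕ} (x : M n) :
    M.relabel (Equiv.refl (Fin n)) x = x := by
  rw [relabel_eq_act]
  have : MulOpposite.op (Equiv.refl (Fin n)) = 1 := rfl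
  simp [act, this]

theorem relabel_relabel (M : SMod.{u, w} K) {m n p : ℕ} (σ : Fin m ≃ Fin n) (τ : Fin n ≃ Fin p)
    (x : M p) : M.relabel σ (M.relabel τ x) = M.relabel (σ.trans τ) x := by
  obtain rfl : m = n := by simpa using Fintype.card_congr σ
  obtain rfl : m = p := by simpa using Fintype.card_congr τ
  simp only [relabel_eq_act, act]
  have : MulOpposite.op (σ.trans τ) = MulOpposite.op σ * MulOpposite.op τ := rfl
  rw [this, map_mul]
  rfl

end SMod

/-! ## The tensor product of `𝕊`-modules -/

section Shuffles

/-- The bijection `[|I|] ⊔ [|Iᶜ|] ≃ [n]` that is increasing onto `I` and onto `Iᶜ`: the shuffle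
given by the ordered partition `(I, Iᶜ)` of `[n]`. -/
abbrev split {n : ℕ} (I : Finset (Fin n)) : Fin (#I) ⊕ Fin (#Iᶜ) ≃ Fin n :=
  finSumEquivOfFinset rfl rfl

variable {p q n : ℕ}

/-- The image of the first summand. -/
def leftSet (e : Fin p ⊕ Fin q ≃ Fin n) : Finset (Fin n) :=
  univ.filter fun x => (e.symm x).isLeft

/-- The increasing enumeration of `leftSet e`, followed by the inverse of `e`. -/
def leftPerm (e : Fin p ⊕ Fin q ≃ Fin n) : Fin (#(leftSet e)) ≃ Fin p :=
  ((leftSet e).orderIsoOfFin rfl).toEquiv.trans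
    { toFun := fun x => (e.symm x).getLeft (by simpa [leftSet] using x.2)
      invFun := fun y => ⟨e (Sum.inl y), by simp [leftSet]⟩
      left_inv := fun x => by ext; simp
      right_inv := fun y => by simp }

/-- The increasing enumeration of the complement of `leftSet e`, followed by the inverse
of `e`. -/
def rightPerm (e : Fin p ⊕ Fin q ≃ Fin n) : Fin (#(leftSet e)ᶜ) ≃ Fin q :=
  ((leftSet e)ᶜ.orderIsoOfFin rfl).toEquiv.trans
    { toFun := fun x => (e.symm x).getRight (by simpa [leftSet] using x.2)
      invFun := fun y => ⟨e (Sum.inr y), by simp [leftSet]⟩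
      left_inv := fun x => by ext; simp
      right_inv := fun y => by simp }

theorem sumCongr_leftPerm_rightPerm (e : Fin p ⊕ Fin q ≃ Fin n) :
    (Equiv.sumCongr (leftPerm e) (rightPerm e)).trans e = split (leftSet e) := by
  ext x
  rcases x with x | x <;> simp [leftPerm, rightPerm, split]

theorem eq_leftSet (e : Fin p ⊕ Fin q ≃ Fin n) (I : Finset (Fin n)) (s : Fin (#I) ≃ Fin p)
    (t : Fin (#Iᶜ) ≃ Fin q) (h : (Equiv.sumCongr s t).trans e = split I) : I = leftSet e := by
  ext x
  obtain ⟨y, rfl⟩ := (split I).surjective x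
  have hy : e.symm (split I y) = Equiv.sumCongr s t y := by rw [← h]; simp
  rcases y with y | y
  · simp only [leftSet, mem_filter, mem_univ, true_and, hy]
    simp [split]
  · simp only [leftSet, mem_filter, mem_univ, true_and, hy]
    have := (Iᶜ).orderEmbOfFin_mem rfl y
    simpa [split] using mem_compl.mp this

end Shuffles

namespace SMod

/-- The graded vector space underlying the tensor product of `𝕊`-modules,
`(M ⊗ N)(n) = ⨁ M(p) ⊗ N(q)` over the ordered partitions `I ⊔ J` of `[n]`, with `p = |I|` and
`q = |J|`; here `J = Iᶜ`. -/
abbrev tensorGr (M N : GrVect.{u, w} K) : GrVect.{u, w} K where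
  carrier n := ⨁ I : Finset (Fin n), M (#I) ⊗[K] N (#Iᶜ)

/-- The summand `m ⊗ n ⊗ (I, Iᶜ)` of the tensor product. -/
abbrev lofT (M N : GrVect.{u, w} K) {n : ℕ} (I : Finset (Fin n)) :
    M (#I) ⊗[K] N (#Iᶜ) →ₗ[K] tensorGr M N n :=
  DirectSum.lof K (Finset (Fin n)) (fun I => M (#I) ⊗[K] N (#Iᶜ)) I

/-- The component at the ordered partition `(I, Iᶜ)`. -/
abbrev compT (M N : GrVect.{u, w} K) {n : ℕ} (I : Finset (Fin n)) :
    tensorGr M N n →ₗ[K] M (#I) ⊗[K] N (#Iᶜ) :=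
  DirectSum.component K (Finset (Fin n)) (fun I => M (#I) ⊗[K] N (#Iᶜ)) I

/-- A bijection `e : [p] ⊔ [q] ≃ [n]` sends `x ⊗ y ∈ M(p) ⊗ N(q)` to an element of
`(M ⊗ N)(n) = ⨁ (M(p) ⊗ N(q)) ⊗_{S_p × S_q} K[S_n]`, the class of `x ⊗ y ⊗ e⁻¹`. In terms of
ordered partitions it is `x · σ ⊗ y · τ ⊗ (I, J)` with `I = e([p])`, `J = e([q])` and the
permutations `σ`, `τ` that make `e` increasing on both blocks. -/
def tmk (M N : SMod.{u, w} K) {p q n : ℕ} (e : Fin p ⊕ Fin q ≃ Fin n) :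
    M p ⊗[K] N q →ₗ[K] tensorGr M.toGrVect N.toGrVect n :=
  lofT M.toGrVect N.toGrVect (leftSet e) ∘ₗ
    TensorProduct.map (M.relabel (leftPerm e)) (N.relabel (rightPerm e))

theorem tmk_eq (M N : SMod.{u, w} K) {p q n : ℕ} (e : Fin p ⊕ Fin q ≃ Fin n)
    (I : Finset (Fin n)) (s : Fin (#I) ≃ Fin p) (t : Fin (#Iᶜ) ≃ Fin q)
    (h : (Equiv.sumCongr s t).trans e = split I) :
    tmk M N e = lofT M.toGrVect N.toGrVect I ∘ₗ
      TensorProduct.map (M.relabel s) (N.relabel t) := by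
  obtain rfl := eq_leftSet e I s t h
  have h' : Equiv.sumCongr s t = Equiv.sumCongr (leftPerm e) (rightPerm e) := by
    rw [← sumCongr_leftPerm_rightPerm] at h
    ext1 x
    exact e.injective (DFunLike.congr_fun h x)
  have hs : s = leftPerm e := by
    ext1 x
    simpa using DFunLike.congr_fun h' (Sum.inl x)
  have ht : t = rightPerm e := by
    ext1 x
    simpa using DFunLike.congr_fun h' (Sum.inr x)
  rw [hs, ht, tmk]

theorem tmk_split (M N : SMod.{u, w} K) {n : ℕ} (I : Finset (Fin n)) :
    tmk M N (split I) = lofT M.toGrVect N.toGrVect I := by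
  rw [tmk_eq M N (split I) I (Equiv.refl _) (Equiv.refl _) (by ext x; rcases x with x | x <;> rfl)]
  refine TensorProduct.ext' fun x y => ?_
  simp [relabel_refl]

theorem tmk_relabel (M N : SMod.{u, w} K) {p q p' q' n : ℕ} (e : Fin p ⊕ Fin q ≃ Fin n)
    (a : Fin p ≃ Fin p') (b : Fin q ≃ Fin q') (x : M p') (y : N q') :
    tmk M N e (M.relabel a x ⊗ₜ N.relabel b y) =
      tmk M N ((Equiv.sumCongr a b).symm.trans e) (x ⊗ₜ y) := by
  rw [tmk_eq M N ((Equiv.sumCongr a b).symm.trans e) (leftSet e) ((leftPerm e).trans a)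
    ((rightPerm e).trans b)]
  · simp [tmk, relabel_relabel]
  · rw [← sumCongr_leftPerm_rightPerm]
    ext x
    rcases x with x | x <;> simp

/-- The right action of `σ` on `(M ⊗ N)(n)`: `(m ⊗ n ⊗ (I, J)) · σ` is
`m · σ|_{σ⁻¹(I)} ⊗ n · σ|_{σ⁻¹(J)} ⊗ (σ⁻¹(I), σ⁻¹(J))`. -/
def tensorAct (M N : SMod.{u, w} K) {n : ℕ} (σ : Equiv.Perm (Fin n)) :
    tensorGr M.toGrVect N.toGrVect n →ₗ[K] tensorGr M.toGrVect N.toGrVect n :=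
  DirectSum.toModule K _ _ fun I => tmk M N ((split I).trans σ.symm)

theorem tensorAct_tmk (M N : SMod.{u, w} K) {p q n : ℕ} (σ : Equiv.Perm (Fin n))
    (e : Fin p ⊕ Fin q ≃ Fin n) (z : M p ⊗[K] N q) :
    tensorAct M N σ (tmk M N e z) = tmk M N (e.trans σ.symm) z := by
  induction z with
  | zero => simp
  | add z z' hz hz' => simp [hz, hz']
  | tmul x y =>
    rw [tmk, LinearMap.comp_apply, TensorProduct.map_tmul, tensorAct]
    erw [DirectSum.toModule_lof]
    rw [tmk_relabel, ← sumCongr_leftPerm_rightPerm]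
    congr 2
    ext x
    simp

/-- The tensor product of `𝕊`-modules. -/
abbrev tensor (M N : SMod.{u, w} K) : SMod.{u, w} K where
  toGrVect := tensorGr M.toGrVect N.toGrVect
  ρ n :=
    { toFun := fun σ => tensorAct M N σ.unop
      map_one' := by
        refine DirectSum.linearMap_ext K fun I => LinearMap.ext fun z => ?_
        have := tensorAct_tmk M N 1 (split I) z
        rw [tmk_split] at this
        exact this.trans (LinearMap.congr_fun (tmk_split M N I) z)
      map_mul' := fun τ σ => by
        refine DirectSum.linearMap_ext K fun I => LinearMap.ext fun z => ?_
        have h := fun σ => tensorAct_tmk M N σ (split I) z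
        rw [tmk_split] at h
        refine (h _).trans (Eq.symm ((congrArg (tensorAct M N τ.unop) (h σ.unop)).trans ?_))
        rw [tensorAct_tmk]
        rfl }

/-- The tensor product `f ⊗ g` of two graded linear maps. -/
def tensorMap {M M' N N' : GrVect.{u, w} K} (f : ∀ n, M n →ₗ[K] M' n) (g : ∀ n, N n →ₗ[K] N' n)
    (n : ℕ) : tensorGr M N n →ₗ[K] tensorGr M' N' n :=
  DirectSum.toModule K _ _ fun I => lofT M' N' I ∘ₗ TensorProduct.map (f (#I)) (g (#Iᶜ))

/-- The bijection `[a] ⊔ [b + c] ≃ [n]` attached to bijections `[a] ⊔ [b] ≃ [p]` and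
`[p] ⊔ [c] ≃ [n]`. -/
def assocShuffle {a b c p n : ℕ} (d : Fin a ⊕ Fin b ≃ Fin p) (e : Fin p ⊕ Fin c ≃ Fin n) :
    Fin a ⊕ Fin (b + c) ≃ Fin n :=
  ((Equiv.sumCongr (Equiv.refl (Fin a)) finSumFinEquiv.symm).trans
    (Equiv.sumAssoc (Fin a) (Fin b) (Fin c)).symm).trans
    ((Equiv.sumCongr d (Equiv.refl (Fin c))).trans e)

/-- The associativity isomorphism `(M ⊗ N) ⊗ L → M ⊗ (N ⊗ L)`; it sends
`m ⊗ n ⊗ l ⊗ (A, B, C)` to `m ⊗ n ⊗ l ⊗ (A, B, C)`. -/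
def assoc (M N L : SMod.{u, w} K) (n : ℕ) :
    tensorGr (tensor M N).toGrVect L.toGrVect n →ₗ[K]
      tensorGr M.toGrVect (tensor N L).toGrVect n :=
  DirectSum.toModule K _ _ fun I => TensorProduct.lift <| DirectSum.toModule K _ _ fun I' =>
    TensorProduct.curry <|
      tmk M (tensor N L) (assocShuffle (split I') (split I)) ∘ₗ
      TensorProduct.map LinearMap.id (tmk N L finSumFinEquiv) ∘ₗ
      (TensorProduct.assoc K (M (#I')) (N (#I'ᶜ)) (L (#Iᶜ))).toLinearMap

/-- The order preserving bijection between `[n]` and the complement of the empty subset. -/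
def emptySplit (n : ℕ) : Fin n ≃ Fin (#(∅ : Finset (Fin n))ᶜ) :=
  (split ∅).symm.trans
    (@Equiv.emptySum _ _ ⟨fun x => (Nat.not_lt_zero x.1) (by simpa using x.2)⟩)

/-- The order preserving bijection between `[n]` and the whole subset of `[n]`. -/
def univSplit (n : ℕ) : Fin n ≃ Fin (#(univ : Finset (Fin n))) :=
  (split univ).symm.trans
    (@Equiv.sumEmpty _ _ ⟨fun x => (Nat.not_lt_zero x.1) (by simpa using x.2)⟩)

/-- `ε ⊗ id : M ⊗ M → 𝟙 ⊗ M = M`, for `ε : M → 𝟙`: only the ordered partition `(∅, [n])`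
contributes. -/
def counitLeft (M : SMod.{u, w} K) (ε : ∀ n, M n →ₗ[K] K) (n : ℕ) :
    tensorGr M.toGrVect M.toGrVect n →ₗ[K] M n :=
  (TensorProduct.lid K (M n)).toLinearMap ∘ₗ
    TensorProduct.map (ε (#∅)) (M.relabel (emptySplit n)) ∘ₗ compT M.toGrVect M.toGrVect ∅

/-- `id ⊗ ε : M ⊗ M → M ⊗ 𝟙 = M`, for `ε : M → 𝟙`: only the ordered partition `([n], ∅)`
contributes. -/
def counitRight (M : SMod.{u, w} K) (ε : ∀ n, M n →ₗ[K] K) (n : ℕ) :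
    tensorGr M.toGrVect M.toGrVect n →ₗ[K] M n :=
  (TensorProduct.rid K (M n)).toLinearMap ∘ₗ
    TensorProduct.map (M.relabel (univSplit n)) (ε (#univᶜ)) ∘ₗ compT M.toGrVect M.toGrVect univ

end SMod

/-! ## The tensor product of graded vector spaces -/

namespace GrVect

/-- `(A ⊗ B)_n = ⨁_{p + q = n} A_p ⊗ B_q`. -/
abbrev tensor (A B : GrVect.{u, w} K) : GrVect.{u, w} K where
  carrier n := ⨁ d : antidiagonal n, A d.1.1 ⊗[K] B d.1.2

/-- The inclusion of the summand `A_p ⊗ B_q`. -/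
abbrev gmk (A B : GrVect.{u, w} K) {p q n : ℕ} (h : p + q = n) :
    A p ⊗[K] B q →ₗ[K] tensor A B n :=
  DirectSum.lof K (antidiagonal n) (fun d => A d.1.1 ⊗[K] B d.1.2) ⟨(p, q), mem_antidiagonal.2 h⟩

/-- The projection to the summand `A_p ⊗ B_q`. -/
abbrev gcomp (A B : GrVect.{u, w} K) {p q n : ℕ} (h : p + q = n) :
    tensor A B n →ₗ[K] A p ⊗[K] B q :=
  DirectSum.component K (antidiagonal n) (fun d => A d.1.1 ⊗[K] B d.1.2)
    ⟨(p, q), mem_antidiagonal.2 h⟩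

/-- The tensor product `f ⊗ g` of two graded linear maps. -/
def tensorMap {A A' B B' : GrVect.{u, w} K} (f : ∀ n, A n →ₗ[K] A' n) (g : ∀ n, B n →ₗ[K] B' n)
    (n : ℕ) : tensor A B n →ₗ[K] tensor A' B' n :=
  DirectSum.toModule K _ _ fun d =>
    gmk A' B' (mem_antidiagonal.1 d.2) ∘ₗ TensorProduct.map (f d.1.1) (g d.1.2)

/-- The associativity isomorphism `(A ⊗ B) ⊗ C → A ⊗ (B ⊗ C)`. -/
def assoc (A B C : GrVect.{u, w} K) (n : ℕ) :
    tensor (tensor A B) C n →ₗ[K] tensor A (tensor B C) n :=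
  DirectSum.toModule K _ _ fun d => TensorProduct.lift <| DirectSum.toModule K _ _ fun d' =>
    TensorProduct.curry <|
      gmk A (tensor B C) (p := d'.1.1) (q := d'.1.2 + d.1.2) (n := n)
        (by rw [← add_assoc, mem_antidiagonal.1 d'.2, mem_antidiagonal.1 d.2]) ∘ₗ
      TensorProduct.map LinearMap.id (gmk B C rfl) ∘ₗ
      (TensorProduct.assoc K (A d'.1.1) (B d'.1.2) (C d.1.2)).toLinearMap

/-- `ε ⊗ id : A ⊗ A → 𝟙 ⊗ A = A`, for `ε : A → 𝟙`. -/
def counitLeft (A : GrVect.{u, w} K) (ε : ∀ n, A n →ₗ[K] K) (n : ℕ) : tensor A A n →ₗ[K] A n :=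
  (TensorProduct.lid K (A n)).toLinearMap ∘ₗ
    TensorProduct.map (ε 0) LinearMap.id ∘ₗ gcomp A A (zero_add n)

/-- `id ⊗ ε : A ⊗ A → A ⊗ 𝟙 = A`, for `ε : A → 𝟙`. -/
def counitRight (A : GrVect.{u, w} K) (ε : ∀ n, A n →ₗ[K] K) (n : ℕ) : tensor A A n →ₗ[K] A n :=
  (TensorProduct.rid K (A n)).toLinearMap ∘ₗ
    TensorProduct.map LinearMap.id (ε 0) ∘ₗ gcomp A A (add_zero n)

end GrVect

/-! ## Operads and their algebras

The `𝕊`-module `P ∘ M` is in degree `n` the direct sum over `k` of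
`P(k) ⊗_{S_k} (M^{⊗ k})(n)`, where `(M^{⊗ k})(n)` is the direct sum over `l : [k] → ℕ` of
`(M(l_1) ⊗ ⋯ ⊗ M(l_k)) ⊗_{S_{l_1} × ⋯ × S_{l_k}} K[bijections ⨆ᵢ [l_i] ≃ [n]]`. A morphism
`P ∘ M → M` of `𝕊`-modules is therefore a family of multilinear operations (`SOps`) which is
compatible with the symmetric groups (`IsPlethysmMap`). -/

/-- The underlying data of a map `P ∘ M → M`: the value on `p ⊗ m_1 ⊗ ⋯ ⊗ m_k ⊗ (T_1, …, T_k)`,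
where `(T_1, …, T_k)` is given by the bijection `e : ⨆ᵢ [l_i] ≃ [n]` with `T_i = e([l_i])`. -/
abbrev SOps (P : GrVect.{u, v} K) (M : GrVect.{u, w} K) :=
  ∀ ⦃k n : ℕ⦄ (l : Fin k → ℕ) (_ : (Σ i : Fin k, Fin (l i)) ≃ Fin n),
    P k →ₗ[K] MultilinearMap K (fun i => M (l i)) (M n)

/-- `μ` is a morphism of `𝕊`-modules `P ∘ M → M`. -/
structure IsPlethysmMap (P : SMod.{u, v} K) (M : SMod.{u, w} K)
    (μ : SOps P.toGrVect M.toGrVect) : Prop where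
  /-- `μ` is equivariant for the right action of `S_n` on `(P ∘ M)(n)` and on `M(n)`. -/
  act_out : ∀ ⦃k n : ℕ⦄ (l : Fin k → ℕ) (e : (Σ i : Fin k, Fin (l i)) ≃ Fin n)
    (σ : Equiv.Perm (Fin n)) (p : P k) (m : ∀ i, M (l i)),
    M.act σ (μ l e p m) = μ l (e.trans σ.symm) p m
  /-- `μ` factors through the tensor product over `S_{l_1} × ⋯ × S_{l_k}`. -/
  act_in : ∀ ⦃k n : ℕ⦄ (l : Fin k → ℕ) (e : (Σ i : Fin k, Fin (l i)) ≃ Fin n)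
    (σ : ∀ i, Equiv.Perm (Fin (l i))) (p : P k) (m : ∀ i, M (l i)),
    μ l e p (fun i => M.act (σ i) (m i)) = μ l ((Equiv.sigmaCongrRight σ).symm.trans e) p m
  /-- `μ` factors through the tensor product over `S_k`: `p · σ ⊗ m_1 ⊗ ⋯ ⊗ m_k ⊗ (T_1, …, T_k)`
  and `p ⊗ m_{σ⁻¹(1)} ⊗ ⋯ ⊗ m_{σ⁻¹(k)} ⊗ (T_{σ⁻¹(1)}, …, T_{σ⁻¹(k)})` have the same image. -/
  act_mid : ∀ ⦃k n : ℕ⦄ (l : Fin k → ℕ) (e : (Σ i : Fin k, Fin (l i)) ≃ Fin n)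
    (σ : Equiv.Perm (Fin k)) (p : P k) (m : ∀ i, M (l i)),
    μ l e (P.act σ p) m =
      μ (fun i => l (σ.symm i))
        ((Equiv.sigmaCongrLeft (β := fun i => Fin (l i)) σ.symm).trans e) p
        (fun i => m (σ.symm i))

/-- The bijection `⨆_{t} [l_{d⁻¹(t)}] ≃ [n]` obtained by composing `d : ⨆ᵢ [r_i] ≃ [s]`,
`c_i : ⨆_j [l_{ij}] ≃ [N_i]` and `e : ⨆ᵢ [N_i] ≃ [n]`: the element `x` of the summand of
`t = d(i, j)` goes to `e(i, c_i(j, x))`. -/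
def assocPartition {k s n : ℕ} {r : Fin k → ℕ} (d : (Σ i : Fin k, Fin (r i)) ≃ Fin s)
    {l : ∀ i, Fin (r i) → ℕ} {N : Fin k → ℕ} (c : ∀ i, (Σ j : Fin (r i), Fin (l i j)) ≃ Fin (N i))
    (e : (Σ i : Fin k, Fin (N i)) ≃ Fin n) :
    (Σ t : Fin s, Fin (l (d.symm t).1 (d.symm t).2)) ≃ Fin n :=
  ((Equiv.sigmaCongrLeft (β := fun ij : (Σ i : Fin k, Fin (r i)) => Fin (l ij.1 ij.2)) d.symm).trans
    (Equiv.sigmaAssoc fun i j => Fin (l i j))).trans ((Equiv.sigmaCongrRight c).trans e)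

/-- `μ (comp ∘ id) = μ (id ∘ μ)` as maps `(P ∘ P) ∘ M = P ∘ (P ∘ M) → M`. -/
def IsAssociative {P : GrVect.{u, v} K} {M : GrVect.{u, w} K} (comp : SOps P P) (μ : SOps P M) :
    Prop :=
  ∀ ⦃k s n : ℕ⦄ (r : Fin k → ℕ) (d : (Σ i : Fin k, Fin (r i)) ≃ Fin s)
    (l : ∀ i, Fin (r i) → ℕ) (N : Fin k → ℕ) (c : ∀ i, (Σ j : Fin (r i), Fin (l i j)) ≃ Fin (N i))
    (e : (Σ i : Fin k, Fin (N i)) ≃ Fin n) (p : P k) (q : ∀ i, P (r i)) (m : ∀ i j, M (l i j)),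
    μ (fun t => l (d.symm t).1 (d.symm t).2) (assocPartition d c e) (comp r d p q)
        (fun t => m (d.symm t).1 (d.symm t).2) =
      μ N e p (fun i => μ (l i) (c i) (q i) (m i))

/-- `μ (η ∘ id) = id` as maps `I ∘ M = M → M`, where `η : I → P` is given by `one ∈ P(1)`. -/
def IsUnital {P : GrVect.{u, v} K} {M : SMod.{u, w} K} (one : P 1) (μ : SOps P M.toGrVect) :
    Prop :=
  ∀ ⦃n : ℕ⦄ (l : Fin 1 → ℕ) (e : (Σ i : Fin 1, Fin (l i)) ≃ Fin n) (m : ∀ i, M (l i)),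
    μ l e one m = M.relabel (e.symm.trans (Equiv.uniqueSigma fun i => Fin (l i))) (m default)

/-- An operad: a monoid `P` in the category of `𝕊`-modules with respect to the plethysm. -/
structure Operad (K : Type u) [Field K] extends SMod.{u, v} K where
  /-- The product `P ∘ P → P`. -/
  comp : SOps toGrVect toGrVect
  /-- The unit `I → P`. -/
  one : carrier 1
  isPlethysmMap : IsPlethysmMap toSMod toSMod comp
  comp_assoc : IsAssociative comp comp
  one_comp : IsUnital (M := toSMod) one comp
  comp_one : ∀ ⦃k n : ℕ⦄ (e : (Σ _ : Fin k, Fin 1) ≃ Fin n) (p : carrier k),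
    comp (fun _ => 1) e p (fun _ => one) =
      toSMod.relabel (e.symm.trans (Equiv.sigmaUnique (Fin k) fun _ => Fin 1)) p

/-- `μ : P ∘ M → M` makes the `𝕊`-module `M` an algebra over the operad `P`. -/
structure IsSModAlgebra (P : Operad.{u, v} K) (M : SMod.{u, w} K)
    (μ : SOps P.toGrVect M.toGrVect) : Prop where
  isPlethysmMap : IsPlethysmMap P.toSMod M μ
  assoc : IsAssociative P.comp μ
  unit : IsUnital P.one μ

/-- The underlying data of a map `P ∘ A → A` for a graded vector space `A`: the value on
`p ⊗ a_1 ⊗ ⋯ ⊗ a_k` with `a_i ∈ A_{l_i}`, where `n` is the sum of the `l_i`. -/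
abbrev GrOps (P : GrVect.{u, v} K) (A : GrVect.{u, w} K) :=
  ∀ ⦃k n : ℕ⦄ (l : Fin k → ℕ) (_ : ∑ i, l i = n),
    P k →ₗ[K] MultilinearMap K (fun i => A (l i)) (A n)

theorem sum_assocPartition {k s : ℕ} {r : Fin k → ℕ} (d : (Σ i : Fin k, Fin (r i)) ≃ Fin s)
    (l : ∀ i, Fin (r i) → ℕ) :
    ∑ t, l (d.symm t).1 (d.symm t).2 = ∑ i, ∑ j, l i j := by
  rw [Equiv.sum_comp d.symm fun ij => l ij.1 ij.2, Fintype.sum_sigma]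

/-- `μ : P ∘ A → A` makes the graded vector space `A` an algebra over the operad `P`. -/
structure IsGrAlgebra (P : Operad.{u, v} K) (A : GrVect.{u, w} K)
    (μ : GrOps P.toGrVect A) : Prop where
  /-- `μ` factors through the tensor product over `S_k`. -/
  act_mid : ∀ ⦃k n : ℕ⦄ (l : Fin k → ℕ) (h : ∑ i, l i = n) (σ : Equiv.Perm (Fin k)) (p : P.carrier k)
    (a : ∀ i, A (l i)),
    μ l h (P.act σ p) a =
      μ (fun i => l (σ.symm i)) ((Equiv.sum_comp σ.symm l).trans h) p (fun i => a (σ.symm i))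
  assoc : ∀ ⦃k s n : ℕ⦄ (r : Fin k → ℕ) (d : (Σ i : Fin k, Fin (r i)) ≃ Fin s)
    (l : ∀ i, Fin (r i) → ℕ) (h : ∑ i, ∑ j, l i j = n)
    (p : P.carrier k) (q : ∀ i, P.carrier (r i)) (a : ∀ i j, A (l i j)),
    μ (fun t => l (d.symm t).1 (d.symm t).2) ((sum_assocPartition d l).trans h) (P.comp r d p q)
        (fun t => a (d.symm t).1 (d.symm t).2) =
      μ (fun i => ∑ j, l i j) h p (fun i => μ (l i) rfl (q i) (a i))
  unit : ∀ ⦃n : ℕ⦄ (a : A n), μ (fun _ : Fin 1 => n) (by simp) P.one (fun _ => a) = a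

/-! ## Hopf operads and Hopf algebras over them -/

/-- A Hopf operad: an operad in the category of coassociative counital coalgebras. -/
structure HopfOperad (K : Type u) [Field K] extends Operad.{u, v} K where
  [coalgebra : ∀ n, Coalgebra K (carrier n)]
  comul_act : ∀ ⦃n : ℕ⦄ (σ : Equiv.Perm (Fin n)) (p : carrier n),
    Coalgebra.comul (R := K) (toSMod.act σ p) =
      TensorProduct.map (toSMod.act σ) (toSMod.act σ) (Coalgebra.comul p)
  counit_act : ∀ ⦃n : ℕ⦄ (σ : Equiv.Perm (Fin n)) (p : carrier n),
    Coalgebra.counit (R := K) (toSMod.act σ p) = Coalgebra.counit (R := K) p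
  comul_comp : ∀ ⦃k n : ℕ⦄ (l : Fin k → ℕ) (e : (Σ i : Fin k, Fin (l i)) ≃ Fin n) (p : carrier k)
    (q : ∀ i, carrier (l i)),
    Coalgebra.comul (R := K) (comp l e p q) =
      pairOps (comp l e) (comp l e) (Coalgebra.comul p) (fun i => Coalgebra.comul (q i))
  counit_comp : ∀ ⦃k n : ℕ⦄ (l : Fin k → ℕ) (e : (Σ i : Fin k, Fin (l i)) ≃ Fin n) (p : carrier k)
    (q : ∀ i, carrier (l i)),
    Coalgebra.counit (R := K) (comp l e p q) =
      Coalgebra.counit (R := K) p * ∏ i, Coalgebra.counit (R := K) (q i)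
  comul_one : Coalgebra.comul (R := K) one = one ⊗ₜ[K] one
  counit_one : Coalgebra.counit (R := K) one = 1

attribute [instance] HopfOperad.coalgebra

/-- The bijection `[∑ a_i] ⊔ [∑ b_i] ≃ [n]` attached to bijections `[a_i] ⊔ [b_i] ≃ [l_i]` and
`⨆ᵢ [l_i] ≃ [n]`; the images of the two summands are the union of the images of the `[a_i]` and
the union of the images of the `[b_i]`. -/
def pairShuffle {k n : ℕ} {a b l : Fin k → ℕ} (s : ∀ i, Fin (a i) ⊕ Fin (b i) ≃ Fin (l i))
    (e : (Σ i : Fin k, Fin (l i)) ≃ Fin n) : Fin (∑ i, a i) ⊕ Fin (∑ i, b i) ≃ Fin n :=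
  ((Equiv.sumCongr finSigmaFinEquiv.symm finSigmaFinEquiv.symm).trans
    (Equiv.sigmaSumDistrib (fun i => Fin (a i)) (fun i => Fin (b i))).symm).trans
    ((Equiv.sigmaCongrRight s).trans e)

/-- The product of the tensor product `M ⊗ N` of two algebras over a Hopf operad, in
`𝕊`-modules. On `m_i ⊗ n_i ⊗ (A_i, B_i)` for `i = 1, …, k` its value is the sum over
`δ(p) = ∑ p₁ ⊗ p₂` of `p₁(m_1, …, m_k) ⊗ p₂(n_1, …, n_k)`, placed on the ordered partition whose
blocks are the union of the `A_i` and the union of the `B_i`. -/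
def SMod.tensorOps (P : HopfOperad.{u, v} K) (M N : SMod.{u, w} K)
    (μ : SOps P.toGrVect M.toGrVect) (ν : SOps P.toGrVect N.toGrVect) :
    SOps P.toGrVect (tensorGr M.toGrVect N.toGrVect) := fun k _ l e =>
  ∑ I : (∀ i : Fin k, Finset (Fin (l i))),
    MultilinearMap.compLinearMapₗ (fun i => compT M.toGrVect N.toGrVect (I i)) ∘ₗ
    LinearMap.compMultilinearMapₗ K (tmk M N (pairShuffle (fun i => split (I i)) e)) ∘ₗ
    pairOps (μ (fun i => #(I i)) finSigmaFinEquiv) (ν (fun i => #(I i)ᶜ) finSigmaFinEquiv) ∘ₗ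
    Coalgebra.comul

theorem sum_antidiagonal {k n : ℕ} {l : Fin k → ℕ} (h : ∑ i, l i = n)
    (d : ∀ i : Fin k, antidiagonal (l i)) : ∑ i, (d i).1.1 + ∑ i, (d i).1.2 = n := by
  rw [← sum_add_distrib, ← h]
  exact sum_congr rfl fun i _ => mem_antidiagonal.1 (d i).2

/-- The product of the tensor product `A ⊗ B` of two algebras over a Hopf operad, in graded
vector spaces: `p(a_1 ⊗ b_1, …, a_k ⊗ b_k) = ∑ p₁(a_1, …, a_k) ⊗ p₂(b_1, …, b_k)`. -/
def GrVect.tensorOps (P : HopfOperad.{u, v} K) (A B : GrVect.{u, w} K)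
    (μ : GrOps P.toGrVect A) (ν : GrOps P.toGrVect B) :
    GrOps P.toGrVect (A.tensor B) := fun k _ l h =>
  ∑ d : (∀ i : Fin k, antidiagonal (l i)),
    MultilinearMap.compLinearMapₗ (fun i => gcomp A B (mem_antidiagonal.1 (d i).2)) ∘ₗ
    LinearMap.compMultilinearMapₗ K (gmk A B (sum_antidiagonal h d)) ∘ₗ
    pairOps (μ (fun i => (d i).1.1) rfl) (ν (fun i => (d i).1.2) rfl) ∘ₗ
    Coalgebra.comul

/-- `(M, μ, Δ, ε)` is a Hopf algebra over the Hopf operad `P` in `𝕊`-modules: `(M, μ)` is a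
`P`-algebra, `(Δ, ε)` is a coassociative and counital coproduct, and `Δ : M → M ⊗ M` and
`ε : M → 𝟙` are morphisms of `P`-algebras in `𝕊`-modules. The unit `𝟙` is `K` in degree `0` and
zero in other degrees, with the product `p(1, …, 1) = ε(p)`. -/
structure IsHopfSModAlgebra (P : HopfOperad.{u, v} K) (M : SMod.{u, w} K)
    (μ : SOps P.toGrVect M.toGrVect)
    (Δ : ∀ n, M n →ₗ[K] SMod.tensorGr M.toGrVect M.toGrVect n)
    (ε : ∀ n, M n →ₗ[K] K) : Prop where
  isAlgebra : IsSModAlgebra P.toOperad M μ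
  comul_act : ∀ ⦃n : ℕ⦄ (σ : Equiv.Perm (Fin n)) (m : M n),
    Δ n (M.act σ m) = (M.tensor M).act σ (Δ n m)
  counit_deg : ∀ ⦃n : ℕ⦄, n ≠ 0 → ε n = 0
  coassoc : ∀ (n : ℕ) (m : M n),
    SMod.assoc M M M n (SMod.tensorMap Δ (fun _ => LinearMap.id) n (Δ n m)) =
      SMod.tensorMap (fun _ => LinearMap.id) Δ n (Δ n m)
  counit_comul : ∀ (n : ℕ) (m : M n), SMod.counitLeft M ε n (Δ n m) = m
  comul_counit : ∀ (n : ℕ) (m : M n), SMod.counitRight M ε n (Δ n m) = m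
  comul_op : ∀ ⦃k n : ℕ⦄ (l : Fin k → ℕ) (e : (Σ i : Fin k, Fin (l i)) ≃ Fin n)
    (p : P.carrier k) (m : ∀ i, M (l i)),
    Δ n (μ l e p m) = SMod.tensorOps P M M μ μ l e p (fun i => Δ (l i) (m i))
  counit_op : ∀ ⦃k n : ℕ⦄ (l : Fin k → ℕ) (e : (Σ i : Fin k, Fin (l i)) ≃ Fin n)
    (p : P.carrier k) (m : ∀ i, M (l i)),
    ε n (μ l e p m) = Coalgebra.counit (R := K) p * ∏ i, ε (l i) (m i)

/-- `(A, μ, Δ, ε)` is a Hopf algebra over the Hopf operad `P` in graded vector spaces. -/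
structure IsHopfGrAlgebra (P : HopfOperad.{u, v} K) (A : GrVect.{u, w} K)
    (μ : GrOps P.toGrVect A) (Δ : ∀ n, A n →ₗ[K] A.tensor A n)
    (ε : ∀ n, A n →ₗ[K] K) : Prop where
  isAlgebra : IsGrAlgebra P.toOperad A μ
  counit_deg : ∀ ⦃n : ℕ⦄, n ≠ 0 → ε n = 0
  coassoc : ∀ (n : ℕ) (a : A n),
    GrVect.assoc A A A n (GrVect.tensorMap Δ (fun _ => LinearMap.id) n (Δ n a)) =
      GrVect.tensorMap (fun _ => LinearMap.id) Δ n (Δ n a)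
  counit_comul : ∀ (n : ℕ) (a : A n), GrVect.counitLeft A ε n (Δ n a) = a
  comul_counit : ∀ (n : ℕ) (a : A n), GrVect.counitRight A ε n (Δ n a) = a
  comul_op : ∀ ⦃k n : ℕ⦄ (l : Fin k → ℕ) (h : ∑ i, l i = n) (p : P.carrier k) (a : ∀ i, A (l i)),
    Δ n (μ l h p a) = GrVect.tensorOps P A A μ μ l h p (fun i => Δ (l i) (a i))
  counit_op : ∀ ⦃k n : ℕ⦄ (l : Fin k → ℕ) (h : ∑ i, l i = n) (p : P.carrier k) (a : ∀ i, A (l i)),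
    ε n (μ l h p a) = Coalgebra.counit (R := K) p * ∏ i, ε (l i) (a i)

/-! ## The symmetrized Hopf algebra

The forgetful functor `O` from `𝕊`-modules to graded vector spaces is `SMod.toGrVect`. -/

/-- The bijection `e : ⨆ᵢ [l_i] ≃ [n]` is increasing on every block; such bijections correspond to
the ordered partitions `(T_1, …, T_k)` of `[n]` with `|T_i| = l_i`, that is, to the
`(l_1, …, l_k)`-shuffles. -/
def IsShuffle {k n : ℕ} {l : Fin k → ℕ} (e : (Σ i : Fin k, Fin (l i)) ≃ Fin n) : Prop :=
  ∀ i, StrictMono fun x : Fin (l i) => e ⟨i, x⟩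

open Classical in
/-- The product `μ̂` on `O(M)`: the composite of `ψ : P ∘ O(M) → O(P ∘ M)`, which sends
`p ⊗ m_1 ⊗ ⋯ ⊗ m_k` to the sum of `p ⊗ m_1 ⊗ ⋯ ⊗ m_k ⊗ (T_1, …, T_k)` over all ordered partitions
with `|T_i| = l_i`, and of `O(μ)`. -/
def symProduct {P : GrVect.{u, v} K} {M : GrVect.{u, w} K} (μ : SOps P M) : GrOps P M :=
  fun k n l _ => ∑ e ∈ univ.filter
    (fun e : (Σ i : Fin k, Fin (l i)) ≃ Fin n => IsShuffle e), μ l e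

/-- The initial segment `[i]` of `[n]`. -/
def initialSeg (n i : ℕ) : Finset (Fin n) := univ.filter fun x => (x : ℕ) < i

theorem card_add_card_compl_fin {n : ℕ} (I : Finset (Fin n)) : #I + #Iᶜ = n := by
  rw [card_add_card_compl, Fintype.card_fin]

/-- The projection `π : O(M ⊗ N) → O(M) ⊗ O(N)`, which is the identity on the terms indexed by a
trivial shuffle `([p], p + [q])` and zero on the other terms. -/
def proj (M N : GrVect.{u, w} K) (n : ℕ) : SMod.tensorGr M N n →ₗ[K] GrVect.tensor M N n :=
  DirectSum.toModule K _ _ fun I =>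
    if I = initialSeg n (#I) then GrVect.gmk M N (card_add_card_compl_fin I) else 0

/-- The coproduct `Δ̄ = π ∘ O(Δ)` on `O(M)`. -/
def symCoproduct {M : GrVect.{u, w} K} (Δ : ∀ n, M n →ₗ[K] SMod.tensorGr M M n) (n : ℕ) :
    M n →ₗ[K] GrVect.tensor M M n :=
  proj M M n ∘ₗ Δ n

end TwistedHopf

end

/-!
The argument has one idea for each half of the structure.

The projection `π` onto trivial shuffles is compatible with all the structure of the two tensor
products. It is natural (`proj_naturality`), it commutes with the associativity isomorphisms
(`assoc_proj`), since an ordered partition `(A, B, C)` consists of consecutive intervals exactly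
when both `(A ∪ B, C)` and `(A, B)` do, and exactly when both `(A, B ∪ C)` and `(B, C)` do, and it
does not affect the counits (`counitLeft_proj`, `counitRight_proj`). Hence `π ∘ O(Δ)` is
coassociative and counital.

Symmetrization turns algebras in `𝕊`-modules into graded algebras, because an outer shuffle and
inner shuffles compose to a shuffle, and each shuffle of the finer blocks arises exactly once in
this way: the outer shuffle is obtained by sorting the blocks (`symProduct_assoc`).

The two constructions fit together because `π` is a morphism of algebras from the symmetrization
of `M ⊗ N` to the tensor product of the symmetrizations (`proj_symProduct`). In the sum over
shuffles `e` and over cuts of the blocks into two pieces, a term survives `π` only if the first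
pieces together fill an initial segment of `[n]`; as `e` is increasing on the blocks, each block is
then cut at an initial segment, and `e` is the juxtaposition of a shuffle of the first pieces and
a shuffle of the second pieces. Finally, `ε` vanishes in positive degrees, and in degree `0` there
is only one shuffle, so `ε` respects the symmetrized product.
-/

noncomputable section

namespace TwistedHopf

variable {K : Type u} [Field K]

open SMod

/-! ### Initial segments and ordered partitions into two blocks -/

section Blocks

variable {p q n : ℕ}

/-- The bijection `[p] ⊔ [q] ≃ [n]` of the trivial shuffle `([p], p + [q])`. -/
def blockSum (h : p + q = n) : Fin p ⊕ Fin q ≃ Fin n :=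
  finSumFinEquiv.trans (finCongr h)

@[simp]
theorem blockSum_inl_val (h : p + q = n) (x : Fin p) : (blockSum h (Sum.inl x) : ℕ) = x := by
  simp [blockSum]

@[simp]
theorem blockSum_inr_val (h : p + q = n) (x : Fin q) :
    (blockSum h (Sum.inr x) : ℕ) = p + x := by
  simp [blockSum]

theorem mem_initialSeg {i : ℕ} {x : Fin n} : x ∈ initialSeg n i ↔ (x : ℕ) < i := by
  simp [initialSeg]

theorem card_initialSeg {i : ℕ} (h : i ≤ n) : #(initialSeg n i) = i := by
  simp [initialSeg, Fin.card_filter_val_lt, h]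

theorem initialSeg_zero : initialSeg n 0 = ∅ := by
  ext; simp [initialSeg]

theorem initialSeg_self : initialSeg n n = univ := by
  ext; simp [initialSeg]

/-- A lower set of size `i` in `[n]` is the initial segment `[i]`: the segment below any of its
elements is contained in it. -/
theorem eq_initialSeg {I : Finset (Fin n)} (h : ∀ x ∈ I, ∀ y, y ≤ x → y ∈ I) :
    I = initialSeg n (#I) := by
  refine eq_of_subset_of_card_le (fun x hx => mem_initialSeg.2 ?_) ?_
  · have : #(Finset.Iic x) ≤ #I := card_le_card fun y hy => h x hx y (mem_Iic.1 hy)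
    rw [Fin.card_Iic] at this
    omega
  · rw [card_initialSeg]
    simpa using card_le_univ I

theorem mem_leftSet (e : Fin p ⊕ Fin q ≃ Fin n) (x : Fin p ⊕ Fin q) :
    e x ∈ leftSet e ↔ x.isLeft := by
  simp [leftSet]

theorem leftSet_split (I : Finset (Fin n)) : leftSet (split I) = I :=
  (eq_leftSet (split I) I (Equiv.refl _) (Equiv.refl _)
    (by ext x; rcases x with x | x <;> rfl)).symm

theorem card_leftSet (e : Fin p ⊕ Fin q ≃ Fin n) : #(leftSet e) = p := by
  simpa using Fintype.card_congr (leftPerm e)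

theorem leftSet_eq_initialSeg_iff (e : Fin p ⊕ Fin q ≃ Fin n) :
    leftSet e = initialSeg n p ↔ ∀ i j, e (Sum.inl i) < e (Sum.inr j) := by
  constructor
  · intro h i j
    have hi := (mem_leftSet e (Sum.inl i)).2 rfl
    have hj := (mem_leftSet e (Sum.inr j)).not.2 (by simp)
    rw [h, mem_initialSeg] at hi hj
    exact Fin.lt_def.2 (by omega)
  · intro h
    have := eq_initialSeg (I := leftSet e) fun x hx y hy => by
      obtain ⟨x, rfl⟩ := e.surjective x
      obtain ⟨y, rfl⟩ := e.surjective y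
      rw [mem_leftSet] at hx ⊢
      rcases x with x | x
      · rcases y with y | y
        · rfl
        · exact absurd (h x y) (not_lt.2 hy)
      · simp at hx
    rwa [card_leftSet] at this

theorem eq_initialSeg_iff_split (I : Finset (Fin n)) :
    I = initialSeg n (#I) ↔ ∀ i j, split I (Sum.inl i) < split I (Sum.inr j) := by
  rw [← leftSet_eq_initialSeg_iff, leftSet_split]

theorem leftSet_blockSum (h : p + q = n) : leftSet (blockSum h) = initialSeg n p :=
  (leftSet_eq_initialSeg_iff _).2 fun i j => Fin.lt_def.2 (by simp; omega)

/-- A bijection whose first block is an initial segment is a pair of permutations of the two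
blocks, followed by the trivial shuffle. -/
theorem exists_sumCongr_blockSum (h : p + q = n) (e : Fin p ⊕ Fin q ≃ Fin n)
    (he : leftSet e = initialSeg n p) :
    ∃ f g, e = (Equiv.sumCongr f g).trans (blockSum h) := by
  set b : Fin p ⊕ Fin q ≃ Fin n := blockSum h
  obtain ⟨⟨f, g⟩, hfg⟩ := Equiv.Perm.mem_sumCongrHom_range_of_perm_mapsTo_inl
    (σ := e.trans b.symm) (by
      rintro _ ⟨x, rfl⟩
      have hx := (mem_leftSet e (Sum.inl x)).2 rfl
      rw [he, ← leftSet_blockSum h] at hx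
      have := (mem_leftSet b (b.symm (e (Sum.inl x)))).1 (by simpa [b] using hx)
      obtain ⟨y, hy⟩ := Sum.isLeft_iff.1 this
      exact ⟨y, hy.symm⟩)
  refine ⟨f, g, ?_⟩
  have : Equiv.sumCongr f g = e.trans b.symm := hfg
  rw [this]
  ext; simp

theorem strictMono_split_inl (I : Finset (Fin n)) : StrictMono fun i => split I (Sum.inl i) := by
  intro i j hij
  simpa [split] using hij

theorem strictMono_split_inr (I : Finset (Fin n)) : StrictMono fun i => split I (Sum.inr i) := by
  intro i j hij
  simpa [split] using hij

theorem perm_eq_refl_of_strictMono {f : Equiv.Perm (Fin n)} (hf : StrictMono f) :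
    f = Equiv.refl _ := by
  have := (Equiv.Perm.monotone_iff f).1 hf.monotone
  exact this

/-- A bijection that is increasing on both blocks and puts the first block below the second is
the trivial shuffle. -/
theorem eq_blockSum (e : Fin p ⊕ Fin q ≃ Fin n) (h : p + q = n)
    (hl : StrictMono fun i => e (Sum.inl i)) (hr : StrictMono fun i => e (Sum.inr i))
    (he : leftSet e = initialSeg n p) : e = blockSum h := by
  obtain ⟨f, g, hfg⟩ := exists_sumCongr_blockSum h e he
  have hf : f = Equiv.refl _ := perm_eq_refl_of_strictMono fun i j hij => by
    have : e _ < e _ := hl hij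
    rw [hfg, Fin.lt_def] at this
    exact Fin.lt_def.2 (by simpa using this)
  have hg : g = Equiv.refl _ := perm_eq_refl_of_strictMono fun i j hij => by
    have : e _ < e _ := hr hij
    rw [hfg, Fin.lt_def] at this
    exact Fin.lt_def.2 (by simpa using this)
  rw [hfg, hf, hg]
  ext x
  simp

theorem split_initialSeg {i : ℕ} (h : i ≤ n) :
    split (initialSeg n i) = blockSum (card_add_card_compl_fin _) :=
  eq_blockSum _ _ (strictMono_split_inl _) (strictMono_split_inr _)
    (by rw [leftSet_split, card_initialSeg h])

end Blocks

/-! ### The projection onto the trivial shuffles -/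

namespace SMod

theorem relabel_relabel_symm (M : SMod.{u, w} K) {m n : ℕ} (σ : Fin m ≃ Fin n) (x : M m) :
    M.relabel σ (M.relabel σ.symm x) = x := by
  rw [relabel_relabel]
  simp [relabel_refl]

theorem tmk_eq_map (M N : SMod.{u, w} K) {p q p' q' n : ℕ} (e : Fin p ⊕ Fin q ≃ Fin n)
    (a : Fin p' ≃ Fin p) (b : Fin q' ≃ Fin q) (z : M p ⊗[K] N q) :
    tmk M N ((Equiv.sumCongr a b).trans e) (TensorProduct.map (M.relabel a) (N.relabel b) z) =
      tmk M N e z := by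
  induction z with
  | zero => simp
  | add z z' hz hz' => simp [hz, hz']
  | tmul x y =>
    rw [TensorProduct.map_tmul, tmk_relabel]
    congr 2
    ext x
    simp

end SMod

section Proj

variable {p q n : ℕ}

theorem proj_lof (M N : GrVect.{u, w} K) (I : Finset (Fin n)) (z : M (#I) ⊗[K] N (#Iᶜ)) :
    proj M N n (lofT M N I z) =
      if I = initialSeg n (#I) then GrVect.gmk M N (card_add_card_compl_fin I) z else 0 := by
  rw [proj]
  erw [DirectSum.toModule_lof]
  split_ifs <;> rfl

theorem gmk_map_finCongr (M N : SMod.{u, w} K) {p' q' : ℕ} (hp : p' = p) (hq : q' = q)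
    (h' : p' + q' = n) (h : p + q = n) (z : M p ⊗[K] N q) :
    GrVect.gmk M.toGrVect N.toGrVect h'
      (TensorProduct.map (M.relabel (finCongr hp)) (N.relabel (finCongr hq)) z) =
    GrVect.gmk M.toGrVect N.toGrVect h z := by
  subst hp hq
  congr 1
  induction z with
  | zero => simp
  | add z z' hz hz' => rw [map_add, hz, hz']
  | tmul x y => exact congrArg₂ (· ⊗ₜ[K] ·) (M.relabel_refl x) (N.relabel_refl y)

theorem proj_tmk_of_ne (M N : SMod.{u, w} K) (e : Fin p ⊕ Fin q ≃ Fin n)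
    (he : leftSet e ≠ initialSeg n p) (z : M p ⊗[K] N q) :
    proj M.toGrVect N.toGrVect n (tmk M N e z) = 0 := by
  rw [tmk, LinearMap.comp_apply, proj_lof, if_neg]
  rwa [card_leftSet]

theorem proj_tmk_blockSum (M N : SMod.{u, w} K) (h : p + q = n) (z : M p ⊗[K] N q) :
    proj M.toGrVect N.toGrVect n (tmk M N (blockSum h) z) =
      GrVect.gmk M.toGrVect N.toGrVect h z := by
  have hp : #(initialSeg n p) = p := card_initialSeg (by omega)
  have hq : #(initialSeg n p)ᶜ = q := by
    have := card_add_card_compl_fin (initialSeg n p)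
    omega
  rw [tmk_eq M N (blockSum h) (initialSeg n p) (finCongr hp) (finCongr hq), LinearMap.comp_apply,
    proj_lof, if_pos (by rw [hp]), gmk_map_finCongr]
  rw [split_initialSeg (by omega)]
  ext x
  rcases x with x | x
  · simp
  · simp [hp]

/-- The projection of `x ⊗ y` placed on `([p], p + [q])` with both blocks permuted. -/
theorem proj_tmk_sumCongr (M N : SMod.{u, w} K) (h : p + q = n) (f : Equiv.Perm (Fin p))
    (g : Equiv.Perm (Fin q)) (z : M p ⊗[K] N q) :
    proj M.toGrVect N.toGrVect n (tmk M N ((Equiv.sumCongr f g).trans (blockSum h)) z) =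
      GrVect.gmk M.toGrVect N.toGrVect h
        (TensorProduct.map (M.act f.symm) (N.act g.symm) z) := by
  rw [← proj_tmk_blockSum, ← tmk_eq_map M N (blockSum h) f g, ← relabel_eq_act, ← relabel_eq_act,
    ← LinearMap.comp_apply (TensorProduct.map (M.relabel f) (N.relabel g)),
    ← TensorProduct.map_comp]
  have h1 : M.relabel f ∘ₗ M.relabel f.symm = LinearMap.id :=
    LinearMap.ext fun x => relabel_relabel_symm M f x
  have h2 : N.relabel g ∘ₗ N.relabel g.symm = LinearMap.id :=
    LinearMap.ext fun x => relabel_relabel_symm N g x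
  rw [h1, h2, TensorProduct.map_id, LinearMap.id_apply]

/-- The component of `x ∈ (M ⊗ N)(n)` at the trivial shuffle `([p], p + [q])`, as an element of
`M(p) ⊗ N(q)`. The relabelings identify `#(initialSeg n p)` with `p` and the size of the
complement with `q`. -/
def blockComp (M N : SMod.{u, w} K) (h : p + q = n) :
    tensorGr M.toGrVect N.toGrVect n →ₗ[K] M p ⊗[K] N q :=
  TensorProduct.map
    (M.relabel (finCongr (card_initialSeg (by omega : p ≤ n)).symm))
    (N.relabel (finCongr (by
      have := card_add_card_compl_fin (initialSeg n p)
      have := card_initialSeg (by omega : p ≤ n)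
      omega : q = #(initialSeg n p)ᶜ))) ∘ₗ
  compT M.toGrVect N.toGrVect (initialSeg n p)

theorem gcomp_proj (M N : SMod.{u, w} K) (h : p + q = n)
    (x : tensorGr M.toGrVect N.toGrVect n) :
    GrVect.gcomp M.toGrVect N.toGrVect h (proj M.toGrVect N.toGrVect n x) =
      blockComp M N h x := by
  suffices H : GrVect.gcomp M.toGrVect N.toGrVect h ∘ₗ proj M.toGrVect N.toGrVect n =
      blockComp M N h from LinearMap.congr_fun H x
  refine DirectSum.linearMap_ext K fun I => LinearMap.ext fun z => ?_
  change GrVect.gcomp M.toGrVect N.toGrVect h (proj M.toGrVect N.toGrVect n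
    (lofT M.toGrVect N.toGrVect I z)) = blockComp M N h (lofT M.toGrVect N.toGrVect I z)
  have hcp : #(initialSeg n p) = p := card_initialSeg (by omega)
  rw [proj_lof, blockComp, LinearMap.comp_apply]
  by_cases hI : I = initialSeg n p
  · subst hI
    rw [if_pos (by rw [hcp]), compT, lofT, DirectSum.component.lof_self,
      ← gmk_map_finCongr M N (p' := p) (q' := q) hcp.symm (by
        have := card_add_card_compl_fin (initialSeg n p); omega) h, DirectSum.component.lof_self]
  · rw [compT, lofT, DirectSum.component.of, dif_neg hI, map_zero]
    split_ifs with h'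
    · rw [DirectSum.component.of, dif_neg]
      intro heq
      have : #I = p := congrArg (fun d => d.1.1) heq
      exact hI (by rw [h', this])
    · simp

theorem proj_naturality {M M' N N' : GrVect.{u, w} K} (f : ∀ n, M n →ₗ[K] M' n)
    (g : ∀ n, N n →ₗ[K] N' n) (n : ℕ) (x : tensorGr M N n) :
    proj M' N' n (SMod.tensorMap f g n x) = GrVect.tensorMap f g n (proj M N n x) := by
  suffices H : proj M' N' n ∘ₗ SMod.tensorMap f g n = GrVect.tensorMap f g n ∘ₗ proj M N n from
    LinearMap.congr_fun H x
  refine DirectSum.linearMap_ext K fun I => LinearMap.ext fun z => ?_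
  change proj M' N' n (SMod.tensorMap f g n (lofT M N I z)) =
    GrVect.tensorMap f g n (proj M N n (lofT M N I z))
  rw [proj_lof, SMod.tensorMap]
  erw [DirectSum.toModule_lof]
  rw [LinearMap.comp_apply, proj_lof]
  split_ifs
  · rw [GrVect.tensorMap]
    erw [DirectSum.toModule_lof]
    rfl
  · simp

end Proj

/-! ### Coassociativity, counits and the components of the coproduct -/

section Coalgebra

/-- The trivial shuffles of `[n]` are indexed by the length `i ≤ n` of the first block. -/
theorem proj_eq_sum (M N : GrVect.{u, w} K) (n : ℕ) (x : tensorGr M N n) :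
    proj M N n x = ∑ i ∈ range (n + 1),
      GrVect.gmk M N (card_add_card_compl_fin (initialSeg n i)) (compT M N (initialSeg n i) x) := by
  suffices H : proj M N n = ∑ i ∈ range (n + 1),
      GrVect.gmk M N (card_add_card_compl_fin (initialSeg n i)) ∘ₗ compT M N (initialSeg n i) by
    simpa [LinearMap.sum_apply] using LinearMap.congr_fun H x
  refine DirectSum.linearMap_ext K fun I => LinearMap.ext fun z => ?_
  change proj M N n (lofT M N I z) = (∑ i ∈ range (n + 1),
      GrVect.gmk M N (card_add_card_compl_fin (initialSeg n i)) ∘ₗ compT M N (initialSeg n i))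
        (lofT M N I z)
  rw [proj_lof, LinearMap.sum_apply]
  have hzero : ∀ i, I ≠ initialSeg n i →
      compT M N (initialSeg n i) (lofT M N I z) = 0 := fun i hi => by
    rw [DirectSum.component.of, dif_neg hi]
  split_ifs with hI
  · have hcard : #I ≤ n := by simpa using card_le_univ I
    rw [sum_eq_single (#I)]
    · rw [LinearMap.comp_apply]
      clear hzero
      generalize hJ : initialSeg n (#I) = J at *
      obtain rfl := hI
      rw [DirectSum.component.lof_self]
    · intro i hi hne
      rw [LinearMap.comp_apply, hzero, map_zero]
      rintro h
      exact hne (by rw [h, card_initialSeg (by simpa [Nat.lt_succ_iff] using hi)])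
    · intro h
      exact absurd (mem_range.2 (by omega)) h
  · symm
    refine sum_eq_zero fun i hi => ?_
    rw [LinearMap.comp_apply, hzero, map_zero]
    rintro rfl
    exact hI (by rw [card_initialSeg (by simpa [Nat.lt_succ_iff] using hi)])

theorem emptySplit_val (n : ℕ) (x : Fin n) : (emptySplit n x : ℕ) = x := by
  obtain ⟨y, rfl⟩ := (emptySplit n).symm.surjective x
  rw [Equiv.apply_symm_apply]
  have h := eq_blockSum (split (∅ : Finset (Fin n))) (card_add_card_compl_fin _)
    (strictMono_split_inl _) (strictMono_split_inr _) (by rw [leftSet_split]; simp [initialSeg])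
  have : (emptySplit n).symm y = split ∅ (Sum.inr y) := rfl
  rw [this, h, blockSum_inr_val, card_empty, zero_add]

theorem univSplit_val (n : ℕ) (x : Fin n) : (univSplit n x : ℕ) = x := by
  obtain ⟨y, rfl⟩ := (univSplit n).symm.surjective x
  rw [Equiv.apply_symm_apply]
  have h := eq_blockSum (split (univ : Finset (Fin n))) (card_add_card_compl_fin _)
    (strictMono_split_inl _) (strictMono_split_inr _)
    (by rw [leftSet_split, ← initialSeg_self, card_initialSeg le_rfl])
  have : (univSplit n).symm y = split univ (Sum.inl y) := rfl
  rw [this, h, blockSum_inl_val]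

theorem counit_relabel_finCongr {M : SMod.{u, w} K} (ε : ∀ n, M n →ₗ[K] K) {m n : ℕ} (h : m = n)
    (x : M n) : ε m (M.relabel (finCongr h) x) = ε n x := by
  subst h
  exact congrArg _ (M.relabel_refl x)

theorem counitLeft_proj (M : SMod.{u, w} K) (ε : ∀ n, M n →ₗ[K] K) (n : ℕ)
    (x : tensorGr M.toGrVect M.toGrVect n) :
    GrVect.counitLeft M.toGrVect ε n (proj M.toGrVect M.toGrVect n x) =
      SMod.counitLeft M ε n x := by
  rw [GrVect.counitLeft, SMod.counitLeft]
  simp only [LinearMap.comp_apply]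
  rw [gcomp_proj, blockComp, LinearMap.comp_apply]
  have h0 : initialSeg n 0 = ∅ := initialSeg_zero
  congr 1
  rw [← LinearMap.comp_apply, ← TensorProduct.map_comp]
  have : ∀ (J : Finset (Fin n)) (hJ : J = ∅) (h : 0 = #J) (h' : n = #Jᶜ),
      TensorProduct.map (ε 0 ∘ₗ M.relabel (finCongr h))
        (LinearMap.id ∘ₗ M.relabel (finCongr h')) (compT M.toGrVect M.toGrVect J x) =
      TensorProduct.map (ε (#∅)) (M.relabel (emptySplit n))
        (compT M.toGrVect M.toGrVect ∅ x) := by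
    rintro J rfl h h'
    congr 2
    · exact LinearMap.ext fun y => counit_relabel_finCongr ε h y
    · rw [LinearMap.id_comp]
      congr 1
      ext y
      simp [emptySplit_val]
  exact this _ h0 _ _

theorem counitRight_proj (M : SMod.{u, w} K) (ε : ∀ n, M n →ₗ[K] K) (n : ℕ)
    (x : tensorGr M.toGrVect M.toGrVect n) :
    GrVect.counitRight M.toGrVect ε n (proj M.toGrVect M.toGrVect n x) =
      SMod.counitRight M ε n x := by
  rw [GrVect.counitRight, SMod.counitRight]
  simp only [LinearMap.comp_apply]
  rw [gcomp_proj, blockComp, LinearMap.comp_apply]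
  have h0 : initialSeg n n = univ := initialSeg_self
  congr 1
  rw [← LinearMap.comp_apply, ← TensorProduct.map_comp]
  have : ∀ (J : Finset (Fin n)) (hJ : J = univ) (h : n = #J) (h' : 0 = #Jᶜ),
      TensorProduct.map (LinearMap.id ∘ₗ M.relabel (finCongr h))
        (ε 0 ∘ₗ M.relabel (finCongr h')) (compT M.toGrVect M.toGrVect J x) =
      TensorProduct.map (M.relabel (univSplit n)) (ε (#univᶜ))
        (compT M.toGrVect M.toGrVect univ x) := by
    rintro J rfl h h'
    congr 2
    · rw [LinearMap.id_comp]
      congr 1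
      ext y
      rw [univSplit_val]
      rfl
    · exact LinearMap.ext fun y => counit_relabel_finCongr ε h' y
  exact this _ h0 _ _

theorem assoc_tmk_split (M N L : SMod.{u, w} K) {n : ℕ} (I : Finset (Fin n))
    (I' : Finset (Fin (#I))) (x : M (#I')) (y : N (#I'ᶜ)) (z : L (#Iᶜ)) :
    SMod.assoc M N L n (lofT _ _ I (lofT _ _ I' (x ⊗ₜ y) ⊗ₜ z)) =
      tmk M (SMod.tensor N L) (assocShuffle (split I') (split I))
        (x ⊗ₜ tmk N L finSumFinEquiv (y ⊗ₜ z)) := by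
  rw [SMod.assoc]
  erw [DirectSum.toModule_lof]
  rw [TensorProduct.lift.tmul]
  erw [DirectSum.toModule_lof]
  rfl

theorem assoc_gmk (A B C : GrVect.{u, w} K) {a b c p n : ℕ} (h' : a + b = p) (h : p + c = n)
    (x : A a) (y : B b) (z : C c) :
    GrVect.assoc A B C n (GrVect.gmk _ _ h (GrVect.gmk A B h' (x ⊗ₜ y) ⊗ₜ z)) =
      GrVect.gmk A (B.tensor C) (by omega) (x ⊗ₜ GrVect.gmk B C rfl (y ⊗ₜ z)) := by
  rw [GrVect.assoc]
  erw [DirectSum.toModule_lof]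
  rw [TensorProduct.lift.tmul]
  erw [DirectSum.toModule_lof]
  rfl

theorem tensorMap_gmk {A A' B B' : GrVect.{u, w} K} (f : ∀ n, A n →ₗ[K] A' n)
    (g : ∀ n, B n →ₗ[K] B' n) {p q n : ℕ} (h : p + q = n) (z : A p ⊗[K] B q) :
    GrVect.tensorMap f g n (GrVect.gmk A B h z) =
      GrVect.gmk A' B' h (TensorProduct.map (f p) (g q) z) := by
  rw [GrVect.tensorMap]
  erw [DirectSum.toModule_lof]
  rfl

theorem assocShuffle_blockSum {a b c p n : ℕ} (h' : a + b = p) (h : p + c = n) :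
    assocShuffle (blockSum h') (blockSum h) = blockSum (by omega) := by
  ext x
  rcases x with x | x
  · simp [assocShuffle]
  · obtain ⟨x, rfl⟩ := finSumFinEquiv.surjective x
    rcases x with x | x
    · simp [assocShuffle]
    · simp [assocShuffle]
      omega

/-- The projection onto trivial shuffles is compatible with the associativity isomorphisms:
`(A, B, C)` consists of consecutive intervals if and only if `(A ∪ B, C)` and `(A, B)` do, if and
only if `(A, B ∪ C)` and `(B, C)` do. -/
theorem assoc_proj (M N L : SMod.{u, w} K) (n : ℕ)
    (x : tensorGr (SMod.tensor M N).toGrVect L.toGrVect n) :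
    GrVect.assoc M.toGrVect N.toGrVect L.toGrVect n
      (GrVect.tensorMap (proj M.toGrVect N.toGrVect) (fun _ => LinearMap.id) n
        (proj (SMod.tensor M N).toGrVect L.toGrVect n x)) =
    GrVect.tensorMap (fun _ => LinearMap.id) (proj N.toGrVect L.toGrVect) n
      (proj M.toGrVect (SMod.tensor N L).toGrVect n (SMod.assoc M N L n x)) := by
  suffices H : GrVect.assoc M.toGrVect N.toGrVect L.toGrVect n ∘ₗ
      GrVect.tensorMap (proj M.toGrVect N.toGrVect) (fun _ => LinearMap.id) n ∘ₗ
        proj (SMod.tensor M N).toGrVect L.toGrVect n =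
      GrVect.tensorMap (fun _ => LinearMap.id) (proj N.toGrVect L.toGrVect) n ∘ₗ
        proj M.toGrVect (SMod.tensor N L).toGrVect n ∘ₗ SMod.assoc M N L n from
    LinearMap.congr_fun H x
  refine DirectSum.linearMap_ext K fun I => ?_
  refine TensorProduct.ext ?_
  refine DirectSum.linearMap_ext K fun I' => ?_
  refine TensorProduct.ext ?_
  refine LinearMap.ext fun x => LinearMap.ext fun y => LinearMap.ext fun z => ?_
  change GrVect.assoc M.toGrVect N.toGrVect L.toGrVect n
      (GrVect.tensorMap (proj M.toGrVect N.toGrVect) (fun _ => LinearMap.id) n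
        (proj (SMod.tensor M N).toGrVect L.toGrVect n
          (lofT _ _ I (lofT M.toGrVect N.toGrVect I' (x ⊗ₜ y) ⊗ₜ z)))) =
    GrVect.tensorMap (fun _ => LinearMap.id) (proj N.toGrVect L.toGrVect) n
      (proj M.toGrVect (SMod.tensor N L).toGrVect n (SMod.assoc M N L n
        (lofT _ _ I (lofT M.toGrVect N.toGrVect I' (x ⊗ₜ y) ⊗ₜ z))))
  rw [assoc_tmk_split]
  by_cases hI : I = initialSeg n (#I) ∧ I' = initialSeg (#I) (#I')
  · obtain ⟨h1, h2⟩ := hI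
    have s1 : split I = blockSum (card_add_card_compl_fin I) :=
      eq_blockSum _ _ (strictMono_split_inl _) (strictMono_split_inr _) (by rwa [leftSet_split])
    have s2 : split I' = blockSum (card_add_card_compl_fin I') :=
      eq_blockSum _ _ (strictMono_split_inl _) (strictMono_split_inr _) (by rwa [leftSet_split])
    rw [proj_lof, if_pos h1, tensorMap_gmk, TensorProduct.map_tmul, proj_lof, if_pos h2,
      LinearMap.id_apply, assoc_gmk, s1, s2, assocShuffle_blockSum, proj_tmk_blockSum,
      tensorMap_gmk, TensorProduct.map_tmul, LinearMap.id_apply]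
    have : (finSumFinEquiv : Fin (#I'ᶜ) ⊕ Fin (#Iᶜ) ≃ _) = blockSum rfl := by
      ext; rfl
    rw [this, proj_tmk_blockSum]
  · have hl : GrVect.assoc M.toGrVect N.toGrVect L.toGrVect n
      (GrVect.tensorMap (proj M.toGrVect N.toGrVect) (fun _ => LinearMap.id) n
        (proj (SMod.tensor M N).toGrVect L.toGrVect n
          (lofT _ _ I (lofT M.toGrVect N.toGrVect I' (x ⊗ₜ y) ⊗ₜ z)))) = 0 := by
      rw [proj_lof]
      split_ifs with h1
      · rw [tensorMap_gmk, TensorProduct.map_tmul, proj_lof, if_neg (fun h2 => hI ⟨h1, h2⟩)]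
        simp
      · simp
    rw [hl]
    symm
    -- If the other side were nonzero, the three blocks would be in increasing order.
    have hcard : #I' + (#I'ᶜ + #Iᶜ) = n := by
      rw [← add_assoc, card_add_card_compl_fin, card_add_card_compl_fin]
    by_cases he : leftSet (assocShuffle (split I') (split I)) = initialSeg n (#I')
    · obtain ⟨f, g, hfg⟩ := exists_sumCongr_blockSum hcard _ he
      rw [hfg, proj_tmk_sumCongr, tensorMap_gmk, TensorProduct.map_tmul, TensorProduct.map_tmul]
      have : (SMod.tensor N L).act g.symm (tmk N L finSumFinEquiv (y ⊗ₜ z)) =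
          tmk N L (finSumFinEquiv.trans g) (y ⊗ₜ z) := by
        exact tensorAct_tmk N L g.symm finSumFinEquiv (y ⊗ₜ z)
      rw [this, proj_tmk_of_ne, TensorProduct.tmul_zero, map_zero]
      intro hg
      refine hI ?_
      have hA : ∀ i, (split I (Sum.inl (split I' (Sum.inl i))) : ℕ) = f i := fun i => by
        have := congrArg Fin.val (DFunLike.congr_fun hfg (Sum.inl i))
        simpa [assocShuffle] using this
      have hB : ∀ i, (split I (Sum.inl (split I' (Sum.inr i))) : ℕ) =
          #I' + g (finSumFinEquiv (Sum.inl i)) := fun i => by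
        have := congrArg Fin.val (DFunLike.congr_fun hfg (Sum.inr (finSumFinEquiv (Sum.inl i))))
        simpa [assocShuffle] using this
      have hC : ∀ i, (split I (Sum.inr i) : ℕ) =
          #I' + g (finSumFinEquiv (Sum.inr i)) := fun i => by
        have := congrArg Fin.val (DFunLike.congr_fun hfg (Sum.inr (finSumFinEquiv (Sum.inr i))))
        simpa [assocShuffle] using this
      rw [leftSet_eq_initialSeg_iff] at hg
      constructor
      · refine (eq_initialSeg_iff_split I).2 fun i j => ?_
        obtain ⟨i, rfl⟩ := (split I').surjective i
        rw [Fin.lt_def]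
        rcases i with i | i
        · rw [hA, hC]
          omega
        · rw [hB, hC]
          have := Fin.lt_def.1 (hg i j)
          simp only [Equiv.trans_apply] at this
          omega
      · refine (eq_initialSeg_iff_split I').2 fun i j => ?_
        refine (strictMono_split_inl I).lt_iff_lt.1 (Fin.lt_def.2 ?_)
        rw [hA, hB]
        omega
    · rw [proj_tmk_of_ne _ _ _ he, map_zero]

end Coalgebra

/-! ### Shuffles -/

section Shuffle

/-- The `(l_1, …, l_k)`-shuffles, that is, the ordered partitions of `[n]` into blocks of sizes
`l_1, …, l_k`. -/
abbrev Shuffle {k : ℕ} (l : Fin k → ℕ) (n : ℕ) :=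
  {e : (Σ i : Fin k, Fin (l i)) ≃ Fin n // IsShuffle e}

instance {k : ℕ} (l : Fin k → ℕ) (n : ℕ) : Fintype (Shuffle l n) :=
  Fintype.ofFinite _

/-- Every bijection becomes a shuffle after sorting each block. -/
theorem exists_isShuffle_trans {k n : ℕ} {N : Fin k → ℕ} (e : (Σ i : Fin k, Fin (N i)) ≃ Fin n) :
    ∃ σ : ∀ i, Equiv.Perm (Fin (N i)), IsShuffle ((Equiv.sigmaCongrRight σ).trans e) := by
  refine ⟨fun i => Tuple.sort fun x => e ⟨i, x⟩, fun i => ?_⟩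
  refine (Tuple.monotone_sort fun x => e ⟨i, x⟩).strictMono_of_injective ?_
  exact (e.injective.comp sigma_mk_injective).comp (Equiv.injective _)

theorem IsShuffle.eq_refl_of_trans {k n : ℕ} {N : Fin k → ℕ}
    {e : (Σ i : Fin k, Fin (N i)) ≃ Fin n} (he : IsShuffle e) {σ : ∀ i, Equiv.Perm (Fin (N i))}
    (hσ : IsShuffle ((Equiv.sigmaCongrRight σ).trans e)) : σ = fun _ => Equiv.refl _ := by
  funext i
  exact perm_eq_refl_of_strictMono fun x y hxy => (he i).lt_iff_lt.1 (hσ i hxy)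

/-- The outer shuffle and the inner bijections are determined by their composite. -/
theorem IsShuffle.ext_of_trans_eq {k n : ℕ} {N : Fin k → ℕ} {X : Fin k → Type*}
    {e e' : (Σ i : Fin k, Fin (N i)) ≃ Fin n} (he : IsShuffle e) (he' : IsShuffle e')
    {c c' : ∀ i, X i ≃ Fin (N i)}
    (h : (Equiv.sigmaCongrRight c).trans e = (Equiv.sigmaCongrRight c').trans e') :
    e = e' ∧ c = c' := by
  have h1 : e' = (Equiv.sigmaCongrRight fun i => (c' i).symm.trans (c i)).trans e := by
    ext ⟨i, x⟩
    have := congrArg Fin.val (DFunLike.congr_fun h ⟨i, (c' i).symm x⟩)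
    simpa using this.symm
  have h2 := he.eq_refl_of_trans (h1 ▸ he')
  refine ⟨?_, ?_⟩
  · rw [h1, h2]
    ext ⟨i, x⟩
    rfl
  · funext i
    have h3 := congrFun h2 i
    ext x
    have := congrArg Fin.val (DFunLike.congr_fun h3 (c' i x))
    simpa using this

/-- Every bijection factors through a shuffle of the outer blocks; `c₀` only records that the blocks
have the sizes `N i`. -/
theorem exists_isShuffle_factor {k n : ℕ} {N : Fin k → ℕ} {X : Fin k → Type*}
    (c₀ : ∀ i, X i ≃ Fin (N i)) (E : (Σ i, X i) ≃ Fin n) :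
    ∃ (e : (Σ i : Fin k, Fin (N i)) ≃ Fin n) (c : ∀ i, X i ≃ Fin (N i)),
      IsShuffle e ∧ (Equiv.sigmaCongrRight c).trans e = E := by
  obtain ⟨σ, hσ⟩ := exists_isShuffle_trans ((Equiv.sigmaCongrRight c₀).symm.trans E)
  refine ⟨_, fun i => (c₀ i).trans (σ i).symm, hσ, ?_⟩
  ext ⟨i, x⟩
  have : (Equiv.sigmaCongrRight c₀).symm ⟨i, c₀ i x⟩ = ⟨i, x⟩ :=
    (Equiv.sigmaCongrRight c₀).symm_apply_apply ⟨i, x⟩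
  simp [this]

theorem isShuffle_assocPartition_iff {k s n : ℕ} {r : Fin k → ℕ}
    (d : (Σ i : Fin k, Fin (r i)) ≃ Fin s) {l : ∀ i, Fin (r i) → ℕ} {N : Fin k → ℕ}
    (c : ∀ i, (Σ j : Fin (r i), Fin (l i j)) ≃ Fin (N i)) {e : (Σ i : Fin k, Fin (N i)) ≃ Fin n}
    (he : IsShuffle e) : IsShuffle (assocPartition d c e) ↔ ∀ i, IsShuffle (c i) := by
  constructor
  · intro h i j x y hxy
    have H : ∀ ij : (Σ i : Fin k, Fin (r i)),
        StrictMono fun x : Fin (l ij.1 ij.2) => e ⟨ij.1, c ij.1 ⟨ij.2, x⟩⟩ := fun ij => by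
      obtain ⟨t, rfl⟩ := d.symm.surjective ij
      exact h t
    exact (he i).lt_iff_lt.1 (H ⟨i, j⟩ hxy)
  · intro h t x y hxy
    exact he _ (h _ _ hxy)

end Shuffle

/-! ### The symmetrized algebra -/

section Algebra

theorem symProduct_apply {P : GrVect.{u, v} K} {M : GrVect.{u, w} K} (μ : SOps P M) {k n : ℕ}
    (l : Fin k → ℕ) (h : ∑ i, l i = n) (p : P k) (m : ∀ i, M (l i)) :
    symProduct μ l h p m = ∑ e : Shuffle l n,
      μ l e.1 p m := by
  classical
  simp only [symProduct, LinearMap.sum_apply, _root_.sum_apply]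
  exact Finset.sum_subtype _ (fun e => by rw [mem_filter]; simp) _

theorem symProduct_act_mid {P : SMod.{u, v} K} {M : SMod.{u, w} K} {μ : SOps P.toGrVect M.toGrVect}
    (hμ : IsPlethysmMap P M μ) {k n : ℕ} (l : Fin k → ℕ) (h : ∑ i, l i = n)
    (σ : Equiv.Perm (Fin k)) (p : P k) (m : ∀ i, M (l i)) :
    symProduct μ l h (P.act σ p) m =
      symProduct μ (fun i => l (σ.symm i)) ((Equiv.sum_comp σ.symm l).trans h) p
        (fun i => m (σ.symm i)) := by
  classical
  rw [symProduct_apply, symProduct_apply]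
  refine Fintype.sum_equiv
    (Equiv.subtypeEquiv (Equiv.equivCongr
      (Equiv.sigmaCongrLeft (β := fun i => Fin (l i)) σ.symm).symm (Equiv.refl _)) fun e => ?_)
    _ _ fun e => hμ.act_mid l e.1 σ p m
  constructor
  · intro he i
    exact he (σ.symm i)
  · intro he i
    obtain ⟨i, rfl⟩ := σ.symm.surjective i
    exact he i

theorem symProduct_assoc {P : Operad.{u, v} K} {M : SMod.{u, w} K}
    {μ : SOps P.toGrVect M.toGrVect} (hμ : IsAssociative P.comp μ) {k s n : ℕ} (r : Fin k → ℕ)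
    (d : (Σ i : Fin k, Fin (r i)) ≃ Fin s) (l : ∀ i, Fin (r i) → ℕ) (h : ∑ i, ∑ j, l i j = n)
    (p : P.carrier k) (q : ∀ i, P.carrier (r i)) (m : ∀ i j, M (l i j)) :
    symProduct μ (fun t => l (d.symm t).1 (d.symm t).2) ((sum_assocPartition d l).trans h)
        (P.comp r d p q) (fun t => m (d.symm t).1 (d.symm t).2) =
      symProduct μ (fun i => ∑ j, l i j) h p (fun i => symProduct μ (l i) rfl (q i) (m i)) := by
  classical
  rw [symProduct_apply, symProduct_apply]
  simp_rw [symProduct_apply]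
  simp_rw [MultilinearMap.map_sum]
  rw [← Fintype.sum_prod_type']
  symm
  let a : (Σ t : Fin s, Fin (l (d.symm t).1 (d.symm t).2)) ≃ Σ i, Σ j, Fin (l i j) :=
    (Equiv.sigmaCongrLeft
      (β := fun ij : (Σ i : Fin k, Fin (r i)) => Fin (l ij.1 ij.2)) d.symm).trans
      (Equiv.sigmaAssoc fun i j => Fin (l i j))
  refine Fintype.sum_bijective
    (fun ec : Shuffle (fun i => ∑ j, l i j) n × ∀ i, Shuffle (l i) (∑ j, l i j) =>
      (⟨assocPartition d (fun i => (ec.2 i).1) ec.1.1,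
        (isShuffle_assocPartition_iff d _ ec.1.2).2 fun i => (ec.2 i).2⟩ :
        Shuffle (fun t => l (d.symm t).1 (d.symm t).2) n))
    ⟨?_, ?_⟩ _ _ ?_
  · rintro ⟨⟨e, he⟩, c⟩ ⟨⟨e', he'⟩, c'⟩ hec
    have hec' : assocPartition d (fun i => (c i).1) e = assocPartition d (fun i => (c' i).1) e' :=
      congrArg Subtype.val hec
    obtain ⟨rfl, h2⟩ := he.ext_of_trans_eq he' (c := fun i => (c i).1) (c' := fun i => (c' i).1) (by
      ext x
      obtain ⟨x, rfl⟩ := a.surjective x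
      exact congrArg Fin.val (DFunLike.congr_fun hec' x))
    have h3 : c = c' := funext fun i => Subtype.ext (congrFun h2 i)
    rw [h3]
  · rintro ⟨E, hE⟩
    obtain ⟨e, c, he, hec⟩ := exists_isShuffle_factor (N := fun i => ∑ j, l i j)
      (fun i => finSigmaFinEquiv (n := l i))
      (a.symm.trans E)
    have hE' : assocPartition d c e = E := by
      ext x
      have := congrArg Fin.val (DFunLike.congr_fun hec (a x))
      rwa [Equiv.trans_apply a.symm, a.symm_apply_apply] at this
    have hc := (isShuffle_assocPartition_iff d c he).1 (hE' ▸ hE)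
    exact ⟨⟨⟨e, he⟩, fun i => ⟨c i, hc i⟩⟩, Subtype.ext hE'⟩
  · rintro ⟨e, c⟩
    exact (hμ r d l _ (fun i => (c i).1) e.1 p q m).symm

theorem symProduct_unit {P : Operad.{u, v} K} {M : SMod.{u, w} K}
    {μ : SOps P.toGrVect M.toGrVect} (hμ : IsUnital P.one μ) {n : ℕ} (m : M n) :
    symProduct μ (fun _ : Fin 1 => n) (by simp) P.one (fun _ => m) = m := by
  rw [symProduct_apply]
  have key : ∀ e : (Σ _ : Fin 1, Fin n) ≃ Fin n, IsShuffle e ↔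
      e = Equiv.uniqueSigma fun _ : Fin 1 => Fin n := fun e => by
    constructor
    · intro he
      have := perm_eq_refl_of_strictMono
        (f := (Equiv.uniqueSigma fun _ : Fin 1 => Fin n).symm.trans e) (he default)
      ext x
      have := congrArg Fin.val (DFunLike.congr_fun this (Equiv.uniqueSigma _ x))
      simpa using this
    · rintro rfl i x y hxy
      obtain rfl : i = default := Subsingleton.elim _ _
      exact hxy
  have hu : ∀ e : Shuffle (fun _ : Fin 1 => n) n,
      μ (fun _ : Fin 1 => n) e.1 P.one (fun _ => m) = m := fun e => by
    rw [hμ, (key e.1).1 e.2]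
    exact (congrArg (fun σ => M.relabel σ m) (Equiv.symm_trans_self _)).trans (M.relabel_refl m)
  rw [Fintype.sum_congr _ _ hu]
  have : Unique (Shuffle (fun _ : Fin 1 => n) n) :=
    { default := ⟨_, (key _).2 rfl⟩
      uniq := fun e => Subtype.ext ((key e.1).1 e.2) }
  simp

theorem IsSModAlgebra.symProduct {P : Operad.{u, v} K} {M : SMod.{u, w} K}
    {μ : SOps P.toGrVect M.toGrVect} (hμ : IsSModAlgebra P M μ) :
    IsGrAlgebra P M.toGrVect (symProduct μ) where
  act_mid := fun _ _ l h σ p a => symProduct_act_mid hμ.isPlethysmMap l h σ p a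
  assoc := fun _ _ _ r d l h p q a => symProduct_assoc hμ.assoc r d l h p q a
  unit := fun _ a => symProduct_unit hμ.unit a

/-- The counit respects the symmetrized product. Both sides vanish unless all
`m i` have degree `0`, and in that case there is only one shuffle. -/
theorem counit_symProduct {P : HopfOperad.{u, v} K} {M : SMod.{u, w} K}
    {μ : SOps P.toGrVect M.toGrVect} {ε : ∀ n, M n →ₗ[K] K} (hε : ∀ ⦃n : ℕ⦄, n ≠ 0 → ε n = 0)
    (hμ : ∀ ⦃k n : ℕ⦄ (l : Fin k → ℕ) (e : (Σ i : Fin k, Fin (l i)) ≃ Fin n) (p : P.carrier k)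
      (m : ∀ i, M (l i)),
      ε n (μ l e p m) = Coalgebra.counit (R := K) p * ∏ i, ε (l i) (m i))
    {k n : ℕ} (l : Fin k → ℕ) (h : ∑ i, l i = n) (p : P.carrier k) (m : ∀ i, M (l i)) :
    ε n (symProduct μ l h p m) = Coalgebra.counit (R := K) p * ∏ i, ε (l i) (m i) := by
  rw [symProduct_apply, map_sum]
  simp_rw [hμ]
  by_cases hl : ∃ i, l i ≠ 0
  · obtain ⟨i, hi⟩ := hl
    have : ∏ i, ε (l i) (m i) = 0 := prod_eq_zero (mem_univ i) (by rw [hε hi]; rfl)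
    simp [this]
  · push Not at hl
    obtain rfl : n = 0 := by rw [← h]; simp [hl]
    have : IsEmpty (Σ i : Fin k, Fin (l i)) := ⟨fun x => (Fin.cast (hl x.1) x.2).elim0⟩
    have : Unique (Shuffle l 0) :=
      { default := ⟨Equiv.equivOfIsEmpty _ _, fun i x =>
          isEmptyElim (⟨i, x⟩ : Σ i : Fin k, Fin (l i))⟩
        uniq := fun e => Subtype.ext (Equiv.ext fun x => isEmptyElim x) }
    simp

end Algebra

/-! ### Multilinear maps on tensor products -/

section Pairing

variable {U V U' V' A B : Type*} [AddCommGroup U] [Module K U] [AddCommGroup V] [Module K V]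
  [AddCommGroup U'] [Module K U'] [AddCommGroup V'] [Module K V']
  [AddCommGroup A] [Module K A] [AddCommGroup B] [Module K B]
  {k : ℕ} {X : Fin k → Type w} {Y : Fin k → Type w'}
  [∀ i, AddCommGroup (X i)] [∀ i, Module K (X i)]
  [∀ i, AddCommGroup (Y i)] [∀ i, Module K (Y i)]

theorem multilinearMap_tensor_ext {F G : MultilinearMap K (fun i => X i ⊗[K] Y i) U}
    (h : ∀ (x : ∀ i, X i) (y : ∀ i, Y i), F (fun i => x i ⊗ₜ y i) = G (fun i => x i ⊗ₜ y i)) :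
    F = G := by
  refine MultilinearMap.ext_of_span_eq_top (γ := fun i => X i × Y i)
    (g := fun i xy => xy.1 ⊗ₜ[K] xy.2) (fun i => ?_) fun j => h (fun i => (j i).1) fun i => (j i).2
  rw [← TensorProduct.span_tmul_eq_top]
  congr 1
  ext z
  simp

/-- Postcomposition with `f ⊗ g`, for families `φ'`, `ψ'` given as the composites `f ∘ φ` and
`g ∘ ψ`. -/
theorem map_pairOps (f : U →ₗ[K] U') (g : V →ₗ[K] V') (φ : A →ₗ[K] MultilinearMap K X U)
    (ψ : B →ₗ[K] MultilinearMap K Y V) (φ' : A →ₗ[K] MultilinearMap K X U')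
    (ψ' : B →ₗ[K] MultilinearMap K Y V') (hφ : ∀ a x, f (φ a x) = φ' a x)
    (hψ : ∀ b y, g (ψ b y) = ψ' b y) (c : A ⊗[K] B) (z : ∀ i, X i ⊗[K] Y i) :
    TensorProduct.map f g (pairOps φ ψ c z) = pairOps φ' ψ' c z := by
  suffices H : (TensorProduct.map f g).compMultilinearMap (pairOps φ ψ c) = pairOps φ' ψ' c from
    congrFun (congrArg DFunLike.coe H) z
  refine multilinearMap_tensor_ext fun x y => ?_
  rw [LinearMap.compMultilinearMap_apply]
  induction c with
  | zero => simp
  | add c c' hc hc' => simp [hc, hc']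
  | tmul a b =>
    simp only [pairOps, TensorProduct.lift.tmul, LinearMap.compl₁₂_apply, tensorPair_tmul,
      TensorProduct.map_tmul, hφ, hψ]

theorem pairOps_sum {ι κ : Type*} [Fintype ι] [Fintype κ]
    {φ : A →ₗ[K] MultilinearMap K X U} {ψ : B →ₗ[K] MultilinearMap K Y V}
    {φs : ι → A →ₗ[K] MultilinearMap K X U} {ψs : κ → B →ₗ[K] MultilinearMap K Y V}
    (hφ : ∀ a x, φ a x = ∑ i, φs i a x) (hψ : ∀ b y, ψ b y = ∑ j, ψs j b y)
    (c : A ⊗[K] B) (z : ∀ i, X i ⊗[K] Y i) :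
    pairOps φ ψ c z = ∑ ij : ι × κ, pairOps (φs ij.1) (ψs ij.2) c z := by
  suffices H : pairOps φ ψ c = ∑ ij : ι × κ, pairOps (φs ij.1) (ψs ij.2) c by
    rw [H, _root_.sum_apply]
  refine multilinearMap_tensor_ext fun x y => ?_
  rw [_root_.sum_apply]
  induction c with
  | zero => simp
  | add c c' hc hc' => simp [hc, hc', sum_add_distrib]
  | tmul a b =>
    simp only [pairOps, TensorProduct.lift.tmul, LinearMap.compl₁₂_apply, tensorPair_tmul,
      hφ, hψ, TensorProduct.sum_tmul, TensorProduct.tmul_sum]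
    rw [sum_comm, Fintype.sum_prod_type]

end Pairing

/-! ### Pairs of shuffles -/

section ShufflePair

variable {k p q n : ℕ} {a b l : Fin k → ℕ}

/-- The bijection which places the first `a i` elements of every block by `f` into `[p]` and the
last `b i` elements by `g` into `p + [q]`. -/
def juxtapose (hab : ∀ i, a i + b i = l i) (h : p + q = n) (f : (Σ i, Fin (a i)) ≃ Fin p)
    (g : (Σ i, Fin (b i)) ≃ Fin q) : (Σ i, Fin (l i)) ≃ Fin n :=
  (Equiv.sigmaCongrRight fun i => blockSum (hab i)).symm.trans
    ((Equiv.sigmaSumDistrib _ _).trans ((Equiv.sumCongr f g).trans (blockSum h)))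

theorem juxtapose_inl (hab : ∀ i, a i + b i = l i) (h : p + q = n) (f : (Σ i, Fin (a i)) ≃ Fin p)
    (g : (Σ i, Fin (b i)) ≃ Fin q) (i : Fin k) (x : Fin (a i)) :
    juxtapose hab h f g ⟨i, blockSum (hab i) (Sum.inl x)⟩ = blockSum h (Sum.inl (f ⟨i, x⟩)) := by
  have : (Equiv.sigmaCongrRight fun i => blockSum (hab i)).symm
      ⟨i, blockSum (hab i) (Sum.inl x)⟩ = ⟨i, Sum.inl x⟩ :=
    (Equiv.sigmaCongrRight fun i => blockSum (hab i)).symm_apply_apply ⟨i, Sum.inl x⟩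
  simp only [juxtapose, Equiv.trans_apply, this]
  rfl

theorem juxtapose_inr (hab : ∀ i, a i + b i = l i) (h : p + q = n) (f : (Σ i, Fin (a i)) ≃ Fin p)
    (g : (Σ i, Fin (b i)) ≃ Fin q) (i : Fin k) (x : Fin (b i)) :
    juxtapose hab h f g ⟨i, blockSum (hab i) (Sum.inr x)⟩ = blockSum h (Sum.inr (g ⟨i, x⟩)) := by
  have : (Equiv.sigmaCongrRight fun i => blockSum (hab i)).symm
      ⟨i, blockSum (hab i) (Sum.inr x)⟩ = ⟨i, Sum.inr x⟩ :=
    (Equiv.sigmaCongrRight fun i => blockSum (hab i)).symm_apply_apply ⟨i, Sum.inr x⟩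
  simp only [juxtapose, Equiv.trans_apply, this]
  rfl

theorem isShuffle_juxtapose_iff (hab : ∀ i, a i + b i = l i) (h : p + q = n)
    (f : (Σ i, Fin (a i)) ≃ Fin p) (g : (Σ i, Fin (b i)) ≃ Fin q) :
    IsShuffle (juxtapose hab h f g) ↔ IsShuffle f ∧ IsShuffle g := by
  constructor
  · intro H
    constructor
    · intro i x y hxy
      have := H i (a := blockSum (hab i) (Sum.inl x)) (b := blockSum (hab i) (Sum.inl y))
        (Fin.lt_def.2 (by simpa using hxy))
      simp only [juxtapose_inl] at this
      exact Fin.lt_def.2 (by simpa using Fin.lt_def.1 this)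
    · intro i x y hxy
      have := H i (a := blockSum (hab i) (Sum.inr x)) (b := blockSum (hab i) (Sum.inr y))
        (Fin.lt_def.2 (by simpa using hxy))
      simp only [juxtapose_inr] at this
      exact Fin.lt_def.2 (by simpa using Fin.lt_def.1 this)
  · rintro ⟨hf, hg⟩ i x y hxy
    obtain ⟨x, rfl⟩ := (blockSum (hab i)).surjective x
    obtain ⟨y, rfl⟩ := (blockSum (hab i)).surjective y
    rw [Fin.lt_def] at hxy
    rcases x with x | x <;> rcases y with y | y
    · simp only [juxtapose_inl, Fin.lt_def, blockSum_inl_val] at hxy ⊢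
      exact hf i hxy
    · simp only [juxtapose_inl, juxtapose_inr, Fin.lt_def, blockSum_inl_val, blockSum_inr_val]
      omega
    · simp only [blockSum_inl_val, blockSum_inr_val] at hxy
      omega
    · simp only [juxtapose_inr, Fin.lt_def, blockSum_inr_val] at hxy ⊢
      have := hg i (Fin.lt_def.2 (by omega : (x : ℕ) < y))
      simpa using this

theorem juxtapose_injective (hab : ∀ i, a i + b i = l i) (h : p + q = n)
    {f f' : (Σ i, Fin (a i)) ≃ Fin p} {g g' : (Σ i, Fin (b i)) ≃ Fin q}
    (H : juxtapose hab h f g = juxtapose hab h f' g') : f = f' ∧ g = g' := by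
  constructor
  · ext ⟨i, x⟩
    have := congrArg Fin.val (DFunLike.congr_fun H ⟨i, blockSum (hab i) (Sum.inl x)⟩)
    simpa [juxtapose_inl] using this
  · ext ⟨i, x⟩
    have := congrArg Fin.val (DFunLike.congr_fun H ⟨i, blockSum (hab i) (Sum.inr x)⟩)
    simpa [juxtapose_inr] using this

theorem pairShuffle_inl (s : ∀ i, Fin (a i) ⊕ Fin (b i) ≃ Fin (l i)) (e : (Σ i, Fin (l i)) ≃ Fin n)
    (i : Fin k) (x : Fin (a i)) :
    pairShuffle s e (Sum.inl (finSigmaFinEquiv ⟨i, x⟩)) = e ⟨i, s i (Sum.inl x)⟩ := by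
  simp [pairShuffle, Sigma.map]

theorem pairShuffle_inr (s : ∀ i, Fin (a i) ⊕ Fin (b i) ≃ Fin (l i)) (e : (Σ i, Fin (l i)) ≃ Fin n)
    (i : Fin k) (x : Fin (b i)) :
    pairShuffle s e (Sum.inr (finSigmaFinEquiv ⟨i, x⟩)) = e ⟨i, s i (Sum.inr x)⟩ := by
  simp [pairShuffle, Sigma.map]

theorem pairShuffle_juxtapose (hab : ∀ i, a i + b i = l i) (h : ∑ i, a i + ∑ i, b i = n)
    (f : (Σ i, Fin (a i)) ≃ Fin (∑ i, a i)) (g : (Σ i, Fin (b i)) ≃ Fin (∑ i, b i)) :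
    pairShuffle (fun i => blockSum (hab i)) (juxtapose hab h f g) =
      (Equiv.sumCongr (finSigmaFinEquiv.symm.trans f) (finSigmaFinEquiv.symm.trans g)).trans
        (blockSum h) := by
  ext x
  rcases x with x | x <;> obtain ⟨⟨i, x⟩, rfl⟩ := finSigmaFinEquiv.surjective x
  · rw [pairShuffle_inl, juxtapose_inl]
    simp
  · rw [pairShuffle_inr, juxtapose_inr]
    simp

theorem juxtapose_of_pairShuffle (hab : ∀ i, a i + b i = l i) (h : ∑ i, a i + ∑ i, b i = n)
    (e : (Σ i, Fin (l i)) ≃ Fin n) (F : Equiv.Perm (Fin (∑ i, a i)))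
    (G : Equiv.Perm (Fin (∑ i, b i)))
    (H : pairShuffle (fun i => blockSum (hab i)) e = (Equiv.sumCongr F G).trans (blockSum h)) :
    juxtapose hab h (finSigmaFinEquiv.trans F) (finSigmaFinEquiv.trans G) = e := by
  ext ⟨i, x⟩
  obtain ⟨x, rfl⟩ := (blockSum (hab i)).surjective x
  rcases x with x | x
  · have := congrArg Fin.val (DFunLike.congr_fun H (Sum.inl (finSigmaFinEquiv ⟨i, x⟩)))
    rw [pairShuffle_inl] at this
    rw [juxtapose_inl, this]
    simp
  · have := congrArg Fin.val (DFunLike.congr_fun H (Sum.inr (finSigmaFinEquiv ⟨i, x⟩)))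
    rw [pairShuffle_inr] at this
    rw [juxtapose_inr, this]
    simp

/-- If all blocks of a shuffle are cut into two pieces such that the first pieces together form an
initial segment, then every first piece is an initial segment of its block. -/
theorem eq_initialSeg_of_pairShuffle {e : (Σ i, Fin (l i)) ≃ Fin n} (he : IsShuffle e)
    (I : ∀ i, Finset (Fin (l i)))
    (h : leftSet (pairShuffle (fun i => split (I i)) e) = initialSeg n (∑ i, #(I i))) (i : Fin k) :
    I i = initialSeg (l i) (#(I i)) := by
  refine (eq_initialSeg_iff_split (I i)).2 fun x y => (he i).lt_iff_lt.1 ?_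
  have := (leftSet_eq_initialSeg_iff _).1 h (finSigmaFinEquiv ⟨i, x⟩) (finSigmaFinEquiv ⟨i, y⟩)
  rwa [pairShuffle_inl, pairShuffle_inr] at this

end ShufflePair

/-! ### The projection is a morphism of algebras -/

section Morphism

theorem SMod.tensorOps_apply (P : HopfOperad.{u, v} K) (M N : SMod.{u, w} K)
    (μ : SOps P.toGrVect M.toGrVect) (ν : SOps P.toGrVect N.toGrVect) {k n : ℕ} (l : Fin k → ℕ)
    (e : (Σ i, Fin (l i)) ≃ Fin n) (p : P.carrier k)
    (x : ∀ i, tensorGr M.toGrVect N.toGrVect (l i)) :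
    SMod.tensorOps P M N μ ν l e p x = ∑ I : (∀ i : Fin k, Finset (Fin (l i))),
      tmk M N (pairShuffle (fun i => split (I i)) e)
        (pairOps (μ (fun i => #(I i)) finSigmaFinEquiv) (ν (fun i => #(I i)ᶜ) finSigmaFinEquiv)
          (Coalgebra.comul p) fun i => compT M.toGrVect N.toGrVect (I i) (x i)) := by
  rw [SMod.tensorOps, LinearMap.sum_apply, _root_.sum_apply]
  rfl

theorem GrVect.tensorOps_apply (P : HopfOperad.{u, v} K) (A B : GrVect.{u, w} K)
    (μ : GrOps P.toGrVect A) (ν : GrOps P.toGrVect B) {k n : ℕ} (l : Fin k → ℕ)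
    (h : ∑ i, l i = n) (p : P.carrier k) (x : ∀ i, A.tensor B (l i)) :
    GrVect.tensorOps P A B μ ν l h p x = ∑ d : (∀ i : Fin k, antidiagonal (l i)),
      gmk A B (sum_antidiagonal h d)
        (pairOps (μ (fun i => (d i).1.1) rfl) (ν (fun i => (d i).1.2) rfl)
          (Coalgebra.comul p) fun i => gcomp A B (mem_antidiagonal.1 (d i).2) (x i)) := by
  rw [GrVect.tensorOps, LinearMap.sum_apply, _root_.sum_apply]
  rfl

variable {P : GrVect.{u, v} K} {M N : SMod.{u, w} K} (μ : SOps P M.toGrVect)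
  (ν : SOps P N.toGrVect)

/-- Invariance under replacing the sizes of the pieces by equal numbers, with relabelings in place
of casts. -/
theorem tmk_pairShuffle_finCongr {k n : ℕ} {a a' b b' l : Fin k → ℕ}
    (ha : ∀ i, a i = a' i) (hb : ∀ i, b i = b' i)
    (s : ∀ i, Fin (a' i) ⊕ Fin (b' i) ≃ Fin (l i)) (s' : ∀ i, Fin (a i) ⊕ Fin (b i) ≃ Fin (l i))
    (hs : ∀ i, s' i = (Equiv.sumCongr (finCongr (ha i)) (finCongr (hb i))).trans (s i))
    (e : (Σ i, Fin (l i)) ≃ Fin n) (c : P k ⊗[K] P k) (z : ∀ i, M (a' i) ⊗[K] N (b' i)) :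
    tmk M N (pairShuffle s' e) (pairOps (μ a finSigmaFinEquiv) (ν b finSigmaFinEquiv) c fun i =>
        TensorProduct.map (M.relabel (finCongr (ha i))) (N.relabel (finCongr (hb i))) (z i)) =
      tmk M N (pairShuffle s e)
        (pairOps (μ a' finSigmaFinEquiv) (ν b' finSigmaFinEquiv) c z) := by
  obtain rfl : a = a' := funext ha
  obtain rfl : b = b' := funext hb
  obtain rfl : s' = s := funext fun i => by
    rw [hs i]
    ext x
    rcases x with x | x <;> rfl
  congr 3
  funext i
  have h1 : M.relabel (finCongr (ha i)) = LinearMap.id := LinearMap.ext fun x => M.relabel_refl x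
  have h2 : N.relabel (finCongr (hb i)) = LinearMap.id := LinearMap.ext fun x => N.relabel_refl x
  rw [h1, h2, TensorProduct.map_id, LinearMap.id_apply]

/-- The summand of the product in `M ⊗ N` in which every block is cut at an initial segment, with
the pieces indexed by `a i` and `b i` in place of the cardinalities of the subsets. -/
theorem tmk_pairShuffle_initialSeg {k n : ℕ} {a b l : Fin k → ℕ} (hab : ∀ i, a i + b i = l i)
    (e : (Σ i, Fin (l i)) ≃ Fin n) (c : P k ⊗[K] P k)
    (x : ∀ i, tensorGr M.toGrVect N.toGrVect (l i)) :
    tmk M N (pairShuffle (fun i => split (initialSeg (l i) (a i))) e)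
      (pairOps (μ (fun i => #(initialSeg (l i) (a i))) finSigmaFinEquiv)
        (ν (fun i => #(initialSeg (l i) (a i))ᶜ) finSigmaFinEquiv) c
        fun i => compT M.toGrVect N.toGrVect (initialSeg (l i) (a i)) (x i)) =
      tmk M N (pairShuffle (fun i => blockSum (hab i)) e)
        (pairOps (μ a finSigmaFinEquiv) (ν b finSigmaFinEquiv) c
          fun i => blockComp M N (hab i) (x i)) := by
  have ha : ∀ i, a i = #(initialSeg (l i) (a i)) := fun i =>
    (card_initialSeg (by have := hab i; omega)).symm
  have hb : ∀ i, b i = #(initialSeg (l i) (a i))ᶜ := fun i => by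
    have := hab i
    have := ha i
    have := card_add_card_compl_fin (initialSeg (l i) (a i))
    omega
  symm
  refine tmk_pairShuffle_finCongr μ ν ha hb _ _ (fun i => ?_) e c
    fun i => compT M.toGrVect N.toGrVect (initialSeg (l i) (a i)) (x i)
  rw [split_initialSeg (by have := hab i; omega)]
  ext x
  rcases x with x | x
  · simp
  · simp [← ha i]

end Morphism

section Morphism

variable {P : HopfOperad.{u, v} K} {M N : SMod.{u, w} K} {μ : SOps P.toGrVect M.toGrVect}
  {ν : SOps P.toGrVect N.toGrVect}

/-- For a shuffle `e`, only those terms of the product in `M ⊗ N` survive the projection in which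
all blocks are cut at initial segments. -/
theorem proj_tensorOps {k n : ℕ} {l : Fin k → ℕ} {e : (Σ i, Fin (l i)) ≃ Fin n}
    (he : IsShuffle e) (p : P.carrier k) (x : ∀ i, tensorGr M.toGrVect N.toGrVect (l i)) :
    proj M.toGrVect N.toGrVect n (SMod.tensorOps P M N μ ν l e p x) =
      ∑ d : (∀ i : Fin k, antidiagonal (l i)), proj M.toGrVect N.toGrVect n
        (tmk M N (pairShuffle (fun i => blockSum (mem_antidiagonal.1 (d i).2)) e)
          (pairOps (μ (fun i => (d i).1.1) finSigmaFinEquiv)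
            (ν (fun i => (d i).1.2) finSigmaFinEquiv) (Coalgebra.comul p)
            fun i => blockComp M N (mem_antidiagonal.1 (d i).2) (x i))) := by
  rw [SMod.tensorOps_apply, map_sum]
  symm
  refine sum_of_injOn (fun d i => initialSeg (l i) (d i).1.1) ?_ (fun _ _ => by simp) ?_ ?_
  · intro d _ d' _ h
    funext i
    have h1 := congrArg Finset.card (congrFun h i)
    have h2 := mem_antidiagonal.1 (d i).2
    have h3 := mem_antidiagonal.1 (d' i).2
    simp only at h1
    rw [card_initialSeg (by omega), card_initialSeg (by omega)] at h1
    exact Subtype.ext (Prod.ext h1 (by omega))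
  · intro I _ hI
    refine proj_tmk_of_ne _ _ _ (fun h => hI ?_) _
    refine ⟨fun i => ⟨(#(I i), #(I i)ᶜ), mem_antidiagonal.2 (card_add_card_compl_fin _)⟩,
      by simp, ?_⟩
    funext i
    exact (eq_initialSeg_of_pairShuffle he I h i).symm
  · intro d _
    rw [tmk_pairShuffle_initialSeg μ ν (fun i => mem_antidiagonal.1 (d i).2)]

/-- The part of the product in `M ⊗ N` in which the blocks are cut at fixed initial segments,
summed over all shuffles: those that survive the projection are the juxtapositions of two
shuffles. -/
theorem sum_proj_tmk_pairShuffle (hμ : IsPlethysmMap P.toSMod M μ)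
    (hν : IsPlethysmMap P.toSMod N ν) {k n : ℕ} {a b l : Fin k → ℕ} (hab : ∀ i, a i + b i = l i)
    (h : ∑ i, a i + ∑ i, b i = n) (c : P.carrier k ⊗[K] P.carrier k)
    (z : ∀ i, M (a i) ⊗[K] N (b i)) :
    ∑ e : Shuffle l n, proj M.toGrVect N.toGrVect n
        (tmk M N (pairShuffle (fun i => blockSum (hab i)) e.1)
          (pairOps (μ a finSigmaFinEquiv) (ν b finSigmaFinEquiv) c z)) =
      GrVect.gmk M.toGrVect N.toGrVect h
        (pairOps (symProduct μ a rfl) (symProduct ν b rfl) c z) := by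
  rw [pairOps_sum (φs := fun f : Shuffle a (∑ i, a i) => μ a f.1)
    (ψs := fun g : Shuffle b (∑ i, b i) => ν b g.1) (fun _ _ => symProduct_apply _ _ _ _ _)
    (fun _ _ => symProduct_apply _ _ _ _ _), map_sum]
  symm
  refine sum_of_injOn (fun fg => ⟨juxtapose hab h fg.1.1 fg.2.1,
    (isShuffle_juxtapose_iff hab h _ _).2 ⟨fg.1.2, fg.2.2⟩⟩) ?_ (fun _ _ => by simp) ?_ ?_
  · rintro ⟨f, g⟩ _ ⟨f', g'⟩ _ hfg
    obtain ⟨h1, h2⟩ := juxtapose_injective hab h (congrArg Subtype.val hfg)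
    exact Prod.ext (Subtype.ext h1) (Subtype.ext h2)
  · rintro ⟨e, he⟩ _ hne
    refine proj_tmk_of_ne _ _ _ (fun hl => hne ?_) _
    obtain ⟨F, G, hFG⟩ := exists_sumCongr_blockSum h _ hl
    have hj := juxtapose_of_pairShuffle hab h e F G hFG
    obtain ⟨hf, hg⟩ := (isShuffle_juxtapose_iff hab h _ _).1 (hj ▸ he)
    exact ⟨(⟨_, hf⟩, ⟨_, hg⟩), by simp, Subtype.ext hj⟩
  · rintro ⟨f, g⟩ _
    rw [pairShuffle_juxtapose, proj_tmk_sumCongr]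
    congr 1
    symm
    -- The permutations that sort `[p]` and `p + [q]` act on the outputs of `μ` and `ν`.
    refine map_pairOps _ _ _ _ _ _ (fun p m => ?_) (fun p m => ?_) c z
    · rw [hμ.act_out]
      congr 3
      ext; simp
    · rw [hν.act_out]
      congr 3
      ext; simp

/-- The projection `π` is a morphism from the symmetrization of `M ⊗ N` to the tensor product of
the symmetrizations of `M` and `N`. -/
theorem proj_symProduct (hμ : IsPlethysmMap P.toSMod M μ) (hν : IsPlethysmMap P.toSMod N ν)
    {k n : ℕ} (l : Fin k → ℕ) (h : ∑ i, l i = n) (p : P.carrier k)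
    (x : ∀ i, tensorGr M.toGrVect N.toGrVect (l i)) :
    proj M.toGrVect N.toGrVect n (symProduct (SMod.tensorOps P M N μ ν) l h p x) =
      GrVect.tensorOps P M.toGrVect N.toGrVect (symProduct μ) (symProduct ν) l h p
        (fun i => proj M.toGrVect N.toGrVect (l i) (x i)) := by
  rw [symProduct_apply, map_sum, GrVect.tensorOps_apply,
    Fintype.sum_congr _ _ fun e : Shuffle l n => proj_tensorOps (μ := μ) (ν := ν) e.2 p x, sum_comm]
  refine Fintype.sum_congr _ _ fun d => ?_
  refine (sum_proj_tmk_pairShuffle hμ hν _ (sum_antidiagonal h d) _ _).trans ?_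
  congr 2
  exact funext fun i => (gcomp_proj M N _ (x i)).symm

end Morphism

/-! ### The symmetrized coproduct -/

theorem tensorMap_tensorMap {A A' A'' B B' B'' : GrVect.{u, w} K} (f : ∀ n, A n →ₗ[K] A' n)
    (f' : ∀ n, A' n →ₗ[K] A'' n) (g : ∀ n, B n →ₗ[K] B' n) (g' : ∀ n, B' n →ₗ[K] B'' n) {n : ℕ}
    (y : A.tensor B n) :
    GrVect.tensorMap f' g' n (GrVect.tensorMap f g n y) =
      GrVect.tensorMap (fun n => f' n ∘ₗ f n) (fun n => g' n ∘ₗ g n) n y := by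
  induction y using DirectSum.induction_on with
  | zero => simp
  | add y y' hy hy' => simp only [map_add, hy, hy']
  | of d y =>
    change GrVect.tensorMap _ _ n (GrVect.tensorMap _ _ n
      (GrVect.gmk _ _ (mem_antidiagonal.1 d.2) y)) =
        GrVect.tensorMap _ _ n (GrVect.gmk _ _ (mem_antidiagonal.1 d.2) y)
    rw [tensorMap_gmk, tensorMap_gmk, tensorMap_gmk, ← LinearMap.comp_apply (TensorProduct.map _ _),
      ← TensorProduct.map_comp]

theorem coassoc_symCoproduct {M : SMod.{u, w} K}
    {Δ : ∀ n, M n →ₗ[K] SMod.tensorGr M.toGrVect M.toGrVect n}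
    (hΔ : ∀ (n : ℕ) (m : M n),
      SMod.assoc M M M n (SMod.tensorMap Δ (fun _ => LinearMap.id) n (Δ n m)) =
        SMod.tensorMap (fun _ => LinearMap.id) Δ n (Δ n m)) (n : ℕ) (m : M n) :
    GrVect.assoc M.toGrVect M.toGrVect M.toGrVect n
        (GrVect.tensorMap (symCoproduct Δ) (fun _ => LinearMap.id) n (symCoproduct Δ n m)) =
      GrVect.tensorMap (fun _ => LinearMap.id) (symCoproduct Δ) n (symCoproduct Δ n m) := by
  have h1 : ∀ y, GrVect.tensorMap (symCoproduct Δ) (fun _ => LinearMap.id) n y =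
      GrVect.tensorMap (proj M.toGrVect M.toGrVect) (fun _ => LinearMap.id) n
        (GrVect.tensorMap (B := M.toGrVect) Δ (fun _ => LinearMap.id) n y) := fun y =>
    (tensorMap_tensorMap (B := M.toGrVect) Δ (proj M.toGrVect M.toGrVect) (fun _ => LinearMap.id)
      (fun _ => LinearMap.id) y).symm
  have h2 : ∀ y, GrVect.tensorMap (fun _ => LinearMap.id) (symCoproduct Δ) n y =
      GrVect.tensorMap (fun _ => LinearMap.id) (proj M.toGrVect M.toGrVect) n
        (GrVect.tensorMap (A := M.toGrVect) (fun _ => LinearMap.id) Δ n y) := fun y =>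
    (tensorMap_tensorMap (A := M.toGrVect) (fun _ => LinearMap.id) (fun _ => LinearMap.id) Δ
      (proj M.toGrVect M.toGrVect) y).symm
  rw [h1, h2, symCoproduct, LinearMap.comp_apply,
    ← proj_naturality (M := M.toGrVect) (fun _ => LinearMap.id) Δ, ← hΔ,
    ← proj_naturality (N := M.toGrVect) Δ fun _ => LinearMap.id]
  exact assoc_proj M M M n _

end TwistedHopf

end

open TwistedHopf in
theorem theorem3p1p3 {K : Type u} [Field K] (P : HopfOperad.{u, v} K) (M : SMod.{u, w} K)
    (μ : SOps P.toGrVect M.toGrVect)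
    (Δ : ∀ n, M n →ₗ[K] SMod.tensorGr M.toGrVect M.toGrVect n)
    (ε : ∀ n, M n →ₗ[K] K)
    (hM : IsHopfSModAlgebra P M μ Δ ε) :
    IsHopfGrAlgebra P M.toGrVect (symProduct μ) (symCoproduct Δ) ε ∧
    ∀ (n : ℕ) (m : M n),
      symCoproduct Δ n m =
        ∑ i ∈ Finset.range (n + 1),
          GrVect.gmk M.toGrVect M.toGrVect (card_add_card_compl_fin (initialSeg n i))
            (SMod.compT M.toGrVect M.toGrVect (initialSeg n i) (Δ n m)) := by
  refine ⟨?_, fun n m => proj_eq_sum _ _ n (Δ n m)⟩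
  exact
    { isAlgebra := hM.isAlgebra.symProduct
      counit_deg := hM.counit_deg
      coassoc := coassoc_symCoproduct hM.coassoc
      counit_comul := fun n m => (counitLeft_proj M ε n _).trans (hM.counit_comul n m)
      comul_counit := fun n m => (counitRight_proj M ε n _).trans (hM.comul_counit n m)
      comul_op := fun k n l h p m => by
        have hp := hM.isAlgebra.isPlethysmMap
        rw [symCoproduct, LinearMap.comp_apply, symProduct_apply, map_sum]
        simp_rw [hM.comul_op]
        rw [← symProduct_apply (SMod.tensorOps P M M μ μ) l h]
        exact proj_symProduct hp hp l h p fun i => Δ (l i) (m i)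
      counit_op := fun _ _ l h p m => counit_symProduct hM.counit_deg hM.counit_op l h p m }
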